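/- Let $\Bbbk$ be an algebraically closed field of characteristic $0$, $\Gamma$ a commutative domain that is finitely generated as a $\Bbbk$-algebra, $K$ its field of fractions, $L/K$ a finite Galois extension with group $G$, and $\mathcal M\subset \mathrm{Aut}_{\Bbbk}(L)$ a submonoid that is closed under conjugation by $G$ and separating (if $m_1,m_2\in\mathcal M$ and $m_1|_K=m_2|_K$, then $m_1=m_2$). Let $\mathcal K=(L*\mathcal M)^G$ be the ring of $G$-invariants in the skew monoid ring $L*\mathcal M$. A Galois ring over $\Gamma$ is a subring $U\subset\mathcal K$ that is generated by $\Gamma$ and finitely many elements and satisfies $KU=UK=\mathcal K$. It is a right (left) Galois order if $W\cap U$ is a finitely generated right (left) $\Gamma$-module for every finite-dimensional right (left) $K$-subspace $W\subset\mathcal K$, and a Galois order if it is both. Let $U$ be a Galois ring over $\Gamma$ and $\mathfrak m\in\mathrm{Specm}\,\Gamma$. Let $\bar\Gamma$ be the integral closure of $\Gamma$ in $L$. For a maximal ideal $\ell$ of $\bar\Gamma$ and $m\in\mathcal M$ put $m\cdot\ell=\{x\in\bar\Gamma : m^{-1}(x)\in\ell\}$. Suppose that for every maximal ideal $\ell$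 of $\bar\Gamma$ lying over $\mathfrak m$ the stabilizer $\{m\in\mathcal M : m\cdot\ell=\ell\}$ is finite. Let the fiber $\Phi(\mathfrak m)$ be the set of maximal left ideals $I$ of $U$ containing $\mathfrak m$, where $I$ and $J$ are identified if $U/I\cong U/J$ as left $U$-modules. A Gelfand–Tsetlin module is a finitely generated left $U$-module $V$ such that $V=\bigoplus_{\mathfrak n\in\mathrm{Specm}\,\Gamma}V(\mathfrak n)$, where $V(\mathfrak n)=\{v\in V : \mathfrak n^k v=0 \text{ for some } k\ge 0\}$. 1. If $U$ is a right Galois order over $\Gamma$, then $\Phi(\mathfrak m)$ is non-empty, $U\mathfrak m\ne U$, and there is a maximal left ideal $I\supset\mathfrak m$ of $U$ such that $V=U/I$ is a simple Gelfand–Tsetlin module with $V(\mathfrak m)\ne 0$. 2. If $U$ is a Galois order over $\Gamma$, then $\Phi(\mathfrak m)$ is finite. -/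

import Mathlib

namespace GaloisOrder

/-! ### Spans over a subring, on the left and on the right -/

section Spans

variable {R : Type*} [Ring R]

/-- The left `A`-submodule of the ring `R` generated by `s`, where `A` is a subring of `R`. -/
def leftSpan (A : Subring R) (s : Set R) : AddSubgroup R :=
  AddSubgroup.closure {x | ∃ a ∈ A, ∃ y ∈ s, x = a * y}

/-- The right `A`-submodule of the ring `R` generated by `s`, where `A` is a subring of `R`. -/
def rightSpan (A : Subring R) (s : Set R) : AddSubgroup R :=
  AddSubgroup.closure {x | ∃ y ∈ s, ∃ a ∈ A, x = y * a}

end Spans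

/-! ### The skew monoid ring and its invariants -/

section Skew

variable {k L : Type*} (K : Type*) [Field k] [Field K] [Field L]
  [Algebra k K] [Algebra k L] [Algebra K L] [IsScalarTower k K L]

/-- The conjugate `g μ g⁻¹` of an automorphism `μ` of `L` by `g` in the Galois group of `L/K`. -/
def conjAut {K : Type*} [Field K] [Algebra k K] [Algebra K L] [IsScalarTower k K L]
    (g : L ≃ₐ[K] L) (μ : L ≃ₐ[k] L) : L ≃ₐ[k] L :=
  g.restrictScalars k * μ * (g.restrictScalars k)⁻¹

/-- The monoid `M` is closed under conjugation by the Galois group of `L/K`. -/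
def IsConjClosed (M : Submonoid (L ≃ₐ[k] L)) : Prop :=
  ∀ g : L ≃ₐ[K] L, ∀ μ ∈ M, conjAut g μ ∈ M

/-- The monoid `M` is separating with respect to `K`: its elements are determined by their
restrictions to `K`. -/
def IsSeparating (M : Submonoid (L ≃ₐ[k] L)) : Prop :=
  ∀ μ ∈ M, ∀ ν ∈ M, (∀ a : K, μ (algebraMap K L a) = ν (algebraMap K L a)) → μ = ν

variable {K} {M : Submonoid (L ≃ₐ[k] L)}

/-- The action of `g` in the Galois group on the skew monoid ring `L * M`, sending `l μ` to
`g(l) (g μ g⁻¹)`. -/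
noncomputable def galAct (hM : IsConjClosed K M) (g : L ≃ₐ[K] L) :
    SkewMonoidAlgebra L M →+ SkewMonoidAlgebra L M :=
  SkewMonoidAlgebra.liftNC
    ((SkewMonoidAlgebra.singleAddHom (1 : M)).comp (g : L →+ L))
    (fun μ : M => SkewMonoidAlgebra.single (⟨conjAut g μ, hM g μ μ.2⟩ : M) (1 : L))

theorem galAct_single (hM : IsConjClosed K M) (g : L ≃ₐ[K] L) (μ : M) (l : L) :
    galAct hM g (SkewMonoidAlgebra.single μ l) =
      SkewMonoidAlgebra.single (⟨conjAut g μ, hM g μ μ.2⟩ : M) (g l) := by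
  simp [galAct, SkewMonoidAlgebra.single_mul_single]

theorem galAct_one (hM : IsConjClosed K M) (g : L ≃ₐ[K] L) : galAct hM g 1 = 1 := by
  rw [SkewMonoidAlgebra.one_def, galAct_single]
  congr 1
  · ext1
    simp [conjAut]
  · simp

theorem galAct_mul (hM : IsConjClosed K M) (g : L ≃ₐ[K] L) (x y : SkewMonoidAlgebra L M) :
    galAct hM g (x * y) = galAct hM g x * galAct hM g y := by
  induction x using SkewMonoidAlgebra.induction_on with
  | zero => simp
  | add x₁ x₂ h₁ h₂ => simp [add_mul, h₁, h₂]
  | single μ a =>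
    induction y using SkewMonoidAlgebra.induction_on with
    | zero => simp
    | add y₁ y₂ h₁ h₂ => simp [mul_add, h₁, h₂]
    | single ν b =>
      simp only [SkewMonoidAlgebra.single_mul_single, galAct_single]
      congr 1
      · ext1
        simp [conjAut, mul_assoc]
      · rw [map_mul]
        congr 1
        change g ((μ : L ≃ₐ[k] L) b) = (conjAut g (μ : L ≃ₐ[k] L)) (g b)
        simp [conjAut, AlgEquiv.aut_inv]

/-- The ring `(L * M)^G` of invariants of the Galois group in the skew monoid ring. -/
noncomputable def invariants (hM : IsConjClosed K M) : Subring (SkewMonoidAlgebra L M) where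
  carrier := {x | ∀ g : L ≃ₐ[K] L, galAct hM g x = x}
  mul_mem' hx hy g := by rw [galAct_mul, hx g, hy g]
  one_mem' g := galAct_one hM g
  add_mem' hx hy g := by rw [map_add, hx g, hy g]
  zero_mem' g := map_zero _
  neg_mem' hx g := by rw [map_neg, hx g]

/-- The embedding of a coefficient ring `A` (with an algebra `L` over it) into `L * M`. -/
noncomputable def coeffHom (A : Type*) [CommRing A] [Algebra A L] (M : Submonoid (L ≃ₐ[k] L)) :
    A →+* SkewMonoidAlgebra L M :=
  (SkewMonoidAlgebra.singleOneRingHom (k := L) (G := M)).comp (algebraMap A L)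

/-- The image of `A` in `L * M`. -/
noncomputable def coeffRing (A : Type*) [CommRing A] [Algebra A L] (M : Submonoid (L ≃ₐ[k] L)) :
    Subring (SkewMonoidAlgebra L M) :=
  (coeffHom A M).range

/-! ### Galois rings and Galois orders -/

/-- `U` is a Galois ring over `Γ`: a subring of the invariants which is generated by `Γ` and
finitely many further elements, with `K U = U K` equal to the whole ring of invariants. -/
structure IsGaloisRing (Γ : Type*) [CommRing Γ] [Algebra Γ L] (hM : IsConjClosed K M)
    (U : Subring (SkewMonoidAlgebra L M)) : Prop where
  le_invariants : U ≤ invariants hM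
  fg : ∃ s : Finset (SkewMonoidAlgebra L M),
    Subring.closure ((coeffRing Γ M : Set (SkewMonoidAlgebra L M)) ∪ s) = U
  left_span : leftSpan (coeffRing K M) U = (invariants hM).toAddSubgroup
  right_span : rightSpan (coeffRing K M) U = (invariants hM).toAddSubgroup

/-- For every finite-dimensional right `K`-subspace `W` of the invariants, `W ∩ U` is a finitely
generated right `Γ`-module. -/
def IsRightOrder (Γ : Type*) [CommRing Γ] [Algebra Γ L] (hM : IsConjClosed K M)
    (U : Subring (SkewMonoidAlgebra L M)) : Prop :=
  ∀ s : Finset (SkewMonoidAlgebra L M), (s : Set (SkewMonoidAlgebra L M)) ⊆ invariants hM →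
    ∃ t : Finset (SkewMonoidAlgebra L M),
      rightSpan (coeffRing K M) (s : Set (SkewMonoidAlgebra L M)) ⊓ U.toAddSubgroup =
        rightSpan (coeffRing Γ M) (t : Set (SkewMonoidAlgebra L M))

/-- For every finite-dimensional left `K`-subspace `W` of the invariants, `W ∩ U` is a finitely
generated left `Γ`-module. -/
def IsLeftOrder (Γ : Type*) [CommRing Γ] [Algebra Γ L] (hM : IsConjClosed K M)
    (U : Subring (SkewMonoidAlgebra L M)) : Prop :=
  ∀ s : Finset (SkewMonoidAlgebra L M), (s : Set (SkewMonoidAlgebra L M)) ⊆ invariants hM →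
    ∃ t : Finset (SkewMonoidAlgebra L M),
      leftSpan (coeffRing K M) (s : Set (SkewMonoidAlgebra L M)) ⊓ U.toAddSubgroup =
        leftSpan (coeffRing Γ M) (t : Set (SkewMonoidAlgebra L M))

/-- The inclusion of `Γ` into a Galois ring over `Γ`. -/
noncomputable def IsGaloisRing.incl {Γ : Type*} [CommRing Γ] [Algebra Γ L]
    {hM : IsConjClosed K M} {U : Subring (SkewMonoidAlgebra L M)} (hU : IsGaloisRing Γ hM U) :
    Γ →+* U :=
  (coeffHom Γ M).codRestrict U fun γ => by
    obtain ⟨s, hs⟩ := hU.fg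
    rw [← hs]
    exact Subring.subset_closure (Or.inl ⟨γ, rfl⟩)

/-! ### Stabilizers of maximal ideals -/

/-- The translate of an ideal `ℓ` of the integral closure of `Γ` in `L` by `μ`: the elements `x`
of the integral closure with `μ⁻¹(x) ∈ ℓ`. It equals the image `μ(ℓ)` if `μ` preserves the
integral closure. If only `μ⁻¹` maps the integral closure into itself, it is the preimage of `ℓ`
under that endomorphism, that is, the image of the point `ℓ` under the induced map of maximal
spectra. -/
def translate {Γ : Type*} [CommRing Γ] [Algebra Γ L] (μ : L ≃ₐ[k] L)
    (ℓ : Ideal (integralClosure Γ L)) : Set (integralClosure Γ L) :=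
  {x | ∃ y ∈ ℓ, (y : L) = μ.symm (x : L)}

/-- The stabilizer of `ℓ` in `M`. -/
def stabilizer {Γ : Type*} [CommRing Γ] [Algebra Γ L] (M : Submonoid (L ≃ₐ[k] L))
    (ℓ : Ideal (integralClosure Γ L)) : Set (L ≃ₐ[k] L) :=
  {μ | μ ∈ M ∧ translate μ ℓ = (ℓ : Set (integralClosure Γ L))}

end Skew

/-! ### Gelfand-Tsetlin modules and fibers -/

section Modules

variable {Γ A : Type*} [CommRing Γ] [Ring A] (φ : Γ →+* A)

/-- The generalized weight space `V(𝔪)`: the vectors killed by some power of `𝔪`, where `Γ` acts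
through `φ`. -/
def weightSpace (V : Type*) [AddCommGroup V] [Module A V] (𝔪 : Ideal Γ) : AddSubgroup V where
  carrier := {v | ∃ n : ℕ, ∀ γ ∈ 𝔪 ^ n, φ γ • v = 0}
  zero_mem' := ⟨0, by simp⟩
  add_mem' := by
    rintro v w ⟨m, hm⟩ ⟨n, hn⟩
    refine ⟨max m n, fun γ hγ => ?_⟩
    rw [smul_add, hm γ (Ideal.pow_le_pow_right (le_max_left m n) hγ),
      hn γ (Ideal.pow_le_pow_right (le_max_right m n) hγ), add_zero]
  neg_mem' := by
    rintro v ⟨n, hn⟩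
    exact ⟨n, fun γ hγ => by rw [smul_neg, hn γ hγ, neg_zero]⟩

open Classical in
/-- A Gelfand-Tsetlin module: a finitely generated module which is the direct sum of its
generalized weight spaces with respect to `Γ`. -/
def IsGelfandTsetlin (V : Type*) [AddCommGroup V] [Module A V] : Prop :=
  Module.Finite A V ∧
    DirectSum.IsInternal fun 𝔪 : MaximalSpectrum Γ => weightSpace φ V 𝔪.asIdeal

/-- The left ideal `A 𝔪` of `A` generated by `𝔪`. -/
def leftIdealGen (𝔪 : Ideal Γ) : Submodule A A :=
  Submodule.span A (φ '' (𝔪 : Set Γ))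

/-- The maximal left ideals of `A` that contain `𝔪`. -/
def MaxLeftIdealOver (𝔪 : Ideal Γ) : Type _ :=
  {I : Submodule A A // IsCoatom I ∧ ∀ γ ∈ 𝔪, φ γ ∈ I}

/-- Two maximal left ideals are identified if the simple modules that they define are
isomorphic. -/
def fiberSetoid (𝔪 : Ideal Γ) : Setoid (MaxLeftIdealOver φ 𝔪) where
  r I J := Nonempty ((A ⧸ I.1) ≃ₗ[A] (A ⧸ J.1))
  iseqv :=
    { refl := fun I => ⟨LinearEquiv.refl A (A ⧸ I.1)⟩
      symm := fun ⟨e⟩ => ⟨e.symm⟩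
      trans := fun ⟨e⟩ ⟨f⟩ => ⟨e.trans f⟩ }

/-- The fiber over `𝔪`: the maximal left ideals `I` of `A` that contain `𝔪`, up to isomorphism of
the simple modules `A ⧸ I`. -/
def Fiber (𝔪 : Ideal Γ) : Type _ :=
  Quotient (fiberSetoid φ 𝔪)

end Modules

end GaloisOrder

/-! Write `Γ̄` for the integral closure of `Γ` in `L` and call its primes over `𝔪` the points over
`𝔪`; there are finitely many. The right order condition forces every `t⁻¹`, `t ∈ M`, to map `Γ̄`
into itself (`IsRightOrder.le_backMonoid`), so `M` acts on primes. As `M` is only a monoid, its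
units (the `t` with `t⁻¹ ∈ M`) are treated apart from the other elements. An element of `M` that
fixes a point over `𝔪`, even up to the Galois group, is a unit, because its powers eventually repeat
(`inv_mem_of_smul_eq`). The set `S` of units moving some point over `𝔪` to a point over `𝔪` is
finite (`finite_unitMovers`), so the elements of `U` supported in `S` form a finitely generated
right `Γ`-module.

The tool is separation of points. Passing from `w` to `x w y` multiplies the coefficient at `t` by
`x t(y)`, so functions `∑ xᵢ t(yᵢ)` act on `L * M`. A prime containing all such functions vanishing
on a finite set `T` comes from a pair `(t • ℓ, ℓ)` with `t ∈ T` (`exists_point_of_pairRing`). Only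
the restrictions of points to `K` matter, up to the Galois group; hence `xᵢ, yᵢ` range over the
integral closure `C` of `Γ` in `K`, and a conductor `d` with `d C ⊆ Γ` brings the results back to
`U`.

Non-emptiness of the fiber is `U𝔪 ≠ U` (`leftIdealGen_ne_top`). Otherwise `1 ∈ U𝔪ⁿ` for all `n`. A
function that kills all coefficients outside `S` and is nonzero at the identity modulo a maximal
ideal `𝔫` of `C` over `𝔪` turns this into `1 ∈ W 𝔫ⁿ` for a fixed finitely generated `C`-module `W`,
against Krull's intersection theorem. Any `U/I` with `I ⊇ 𝔪` is Gelfand–Tsetlin, since each vector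
generates a finite-dimensional `Γ`-submodule.

For finiteness of the fiber, an element of `U` with no unit in its support lies in every maximal
left ideal over `𝔪` (`IsGaloisRing.mem_of_support`): otherwise long words in non-units would trace
paths through points over `𝔪`, and the pigeonhole principle would produce a unit. Only the part
supported at units matters, and modulo `𝔪` it can be moved into a finitely generated module
(`exists_unitPart_mem`). Elements that are scalar modulo the left ideals in question are thus
combinations of `n` fixed elements (`IsGaloisRing.exists_finset_congr`). By density, `n + 1`
non-isomorphic simple quotients would give `n + 1` such elements acting as independent idempotents
on the generators, which linear algebra forbids. -/

namespace GaloisOrder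

/-! ### Functions `∑ xᵢ t(yᵢ)` on `M` and their action on coefficients. -/

section PairFunctions

variable {k L : Type*} [Field k] [Field L] [Algebra k L] {M : Submonoid (L ≃ₐ[k] L)}

/-- The function `t ↦ x t(y)` on `M`. -/
def pairFun (M : Submonoid (L ≃ₐ[k] L)) (x y : L) : M → L := fun t => x * (t : L ≃ₐ[k] L) y

theorem pairFun_apply (x y : L) (t : M) : pairFun M x y t = x * (t : L ≃ₐ[k] L) y := rfl

theorem pairFun_mul_pairFun (x y x' y' : L) :
    pairFun M x y * pairFun M x' y' = pairFun M (x * x') (y * y') := by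
  funext t
  simp only [Pi.mul_apply, pairFun_apply, map_mul]
  ring

theorem pairFun_one_one : pairFun M (1 : L) 1 = 1 := by
  funext t
  simp [pairFun_apply]

/-- The functions `t ↦ ∑ xᵢ t(yᵢ)` on `M` with `xᵢ, yᵢ ∈ C`. -/
def pairRing (M : Submonoid (L ≃ₐ[k] L)) (C : Subring L) : Subring (M → L) where
  __ := AddSubgroup.closure {a | ∃ x ∈ C, ∃ y ∈ C, a = pairFun M x y}
  one_mem' := AddSubgroup.subset_closure ⟨1, C.one_mem, 1, C.one_mem, pairFun_one_one.symm⟩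
  mul_mem' {a b} ha hb := by
    refine AddSubgroup.closure_induction (p := fun a _ => a * b ∈ AddSubgroup.closure
      {a | ∃ x ∈ C, ∃ y ∈ C, a = pairFun M x y}) ?_ ?_ ?_ ?_ ha
    · rintro _ ⟨x, hx, y, hy, rfl⟩
      refine AddSubgroup.closure_induction (p := fun b _ => pairFun M x y * b ∈
        AddSubgroup.closure {a | ∃ x ∈ C, ∃ y ∈ C, a = pairFun M x y}) ?_ ?_ ?_ ?_ hb
      · rintro _ ⟨x', hx', y', hy', rfl⟩
        rw [pairFun_mul_pairFun]
        exact AddSubgroup.subset_closure ⟨_, C.mul_mem hx hx', _, C.mul_mem hy hy', rfl⟩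
      · simp
      · intro b c _ _ hb hc
        rw [mul_add]
        exact add_mem hb hc
      · intro b _ hb
        rw [mul_neg]
        exact neg_mem hb
    · simp
    · intro a c _ _ ha hc
      rw [add_mul]
      exact add_mem ha hc
    · intro a _ ha
      rw [neg_mul]
      exact neg_mem ha

theorem pairFun_mem_pairRing {C : Subring L} {x y : L} (hx : x ∈ C) (hy : y ∈ C) :
    pairFun M x y ∈ pairRing M C :=
  AddSubgroup.subset_closure ⟨x, hx, y, hy, rfl⟩

theorem pairRing_induction {C : Subring L} {p : (M → L) → Prop}
    (pair : ∀ x ∈ C, ∀ y ∈ C, p (pairFun M x y)) (zero : p 0)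
    (add : ∀ a b, p a → p b → p (a + b)) (neg : ∀ a, p a → p (-a))
    {a : M → L} (ha : a ∈ pairRing M C) : p a := by
  refine AddSubgroup.closure_induction (p := fun a _ => p a) ?_ zero
    (fun a b _ _ => add a b) (fun a _ => neg a) ha
  rintro _ ⟨x, hx, y, hy, rfl⟩
  exact pair x hx y hy

theorem pairRing_mono {C C' : Subring L} (h : C ≤ C') : pairRing M C ≤ pairRing M C' := by
  intro a ha
  refine pairRing_induction (p := fun a => a ∈ pairRing M C') ?_ ?_ ?_ ?_ ha
  · exact fun x hx y hy => pairFun_mem_pairRing (h hx) (h hy)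
  · exact zero_mem _
  · exact fun a b => add_mem
  · exact fun a => neg_mem

/-- Multiplication of all coefficients by the values of a function on `M`. -/
noncomputable def scale (a : M → L) : SkewMonoidAlgebra L M →+ SkewMonoidAlgebra L M where
  toFun w := ⟨Finsupp.onFinset w.support (fun t => a t * w.coeff t) fun t ht =>
    SkewMonoidAlgebra.mem_support_iff.2 (right_ne_zero_of_mul ht)⟩
  map_zero' := by ext; simp
  map_add' v w := by ext; simp [mul_add]

@[simp]
theorem coeff_scale (a : M → L) (w : SkewMonoidAlgebra L M) (t : M) :
    (scale a w).coeff t = a t * w.coeff t := by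
  simp [scale]

theorem scale_mul (a b : M → L) (w : SkewMonoidAlgebra L M) :
    scale (a * b) w = scale a (scale b w) := by
  ext t; simp [mul_assoc]

theorem scale_add (a b : M → L) (w : SkewMonoidAlgebra L M) :
    scale (a + b) w = scale a w + scale b w := by
  ext t; simp [add_mul]

theorem scale_neg (a : M → L) (w : SkewMonoidAlgebra L M) :
    scale (-a) w = -scale a w := by
  ext t; simp

@[simp]
theorem scale_zero (w : SkewMonoidAlgebra L M) : scale (0 : M → L) w = 0 := by
  ext t; simp

@[simp]
theorem scale_one (w : SkewMonoidAlgebra L M) : scale (1 : M → L) w = w := by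
  ext t; simp

open SkewMonoidAlgebra in
theorem coeff_mul_coe (w : SkewMonoidAlgebra L M) (y : L) (t : M) :
    (w * single 1 y).coeff t = w.coeff t * (t : L ≃ₐ[k] L) y := by
  rw [coeff_mul_single_one]; rfl

open SkewMonoidAlgebra in
theorem scale_pairFun (x y : L) (w : SkewMonoidAlgebra L M) :
    scale (pairFun M x y) w = single 1 x * w * single 1 y := by
  ext t
  rw [coeff_scale, coeff_mul_coe, coeff_single_one_mul, pairFun_apply]
  ring

open SkewMonoidAlgebra in
theorem scale_mul_coe (a : M → L) (y : L) (w : SkewMonoidAlgebra L M) :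
    scale a (w * single 1 y) = scale a w * single 1 y := by
  ext t
  rw [coeff_scale, coeff_mul_coe, coeff_mul_coe, coeff_scale, mul_assoc]

theorem scale_mem {C : Subring L} {U : AddSubgroup (SkewMonoidAlgebra L M)}
    {w : SkewMonoidAlgebra L M}
    (h : ∀ x ∈ C, ∀ y ∈ C,
      SkewMonoidAlgebra.single 1 x * w * SkewMonoidAlgebra.single 1 y ∈ U)
    {a : M → L} (ha : a ∈ pairRing M C) : scale a w ∈ U := by
  refine pairRing_induction (p := fun a => scale a w ∈ U) ?_ ?_ ?_ ?_ ha
  · intro x hx y hy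
    rw [scale_pairFun]
    exact h x hx y hy
  · rw [scale_zero]; exact zero_mem _
  · intro a b ha hb
    rw [scale_add]; exact add_mem ha hb
  · intro a ha
    rw [scale_neg]; exact neg_mem ha

/-- The coefficients of `w` when they are written on the right. It turns right multiplication by
elements of `L` into the multiplication of functions by scalars. -/
noncomputable def rightCoeff : SkewMonoidAlgebra L M →+ (M → L) where
  toFun w t := (t : L ≃ₐ[k] L).symm (w.coeff t)
  map_zero' := by funext; simp
  map_add' v w := by funext; simp

theorem rightCoeff_apply (w : SkewMonoidAlgebra L M) (t : M) :
    rightCoeff w t = (t : L ≃ₐ[k] L).symm (w.coeff t) := rfl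

theorem rightCoeff_injective :
    Function.Injective (rightCoeff : SkewMonoidAlgebra L M →+ (M → L)) := by
  intro v w h
  ext t
  exact (t : L ≃ₐ[k] L).symm.injective (congrFun h t)

theorem rightCoeff_mul_coe (w : SkewMonoidAlgebra L M) (y : L) :
    rightCoeff (w * SkewMonoidAlgebra.single 1 y) = y • rightCoeff w := by
  funext t
  simp [rightCoeff_apply, coeff_mul_coe, mul_comm]

end PairFunctions

/-! ### The action on primes of the integral closure. -/

section Points

variable (Γ k : Type*) {L : Type*} [CommRing Γ] [Field k] [Field L] [Algebra Γ L] [Algebra k L]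

variable (L) in
/-- The automorphisms whose inverse maps the integral closure of `Γ` into itself. -/
def backMonoid : Submonoid (L ≃ₐ[k] L) where
  carrier := {σ | ∀ x ∈ integralClosure Γ L, σ.symm x ∈ integralClosure Γ L}
  one_mem' _ hx := hx
  mul_mem' hσ hτ x hx := hτ _ (hσ x hx)

variable {Γ k}

/-- The restriction of `σ⁻¹` to the integral closure of `Γ`. -/
def backHom (σ : backMonoid Γ k L) : integralClosure Γ L →+* integralClosure Γ L where
  toFun x := ⟨(σ : L ≃ₐ[k] L).symm x, σ.2 x x.2⟩
  map_one' := by ext; simp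
  map_mul' _ _ := by ext; simp
  map_zero' := by ext; simp
  map_add' _ _ := by ext; simp

theorem coe_backHom (σ : backMonoid Γ k L) (x : integralClosure Γ L) :
    (backHom σ x : L) = (σ : L ≃ₐ[k] L).symm x := rfl

/-- Inversion and pullback each reverse the order of composition, so this is a left action. -/
instance : MulAction (backMonoid Γ k L) (Ideal (integralClosure Γ L)) where
  smul σ ℓ := ℓ.comap (backHom σ)
  one_smul _ := rfl
  mul_smul _ _ _ := rfl

theorem mem_smul_ideal (σ : backMonoid Γ k L) (ℓ : Ideal (integralClosure Γ L))
    (x : integralClosure Γ L) : x ∈ σ • ℓ ↔ backHom σ x ∈ ℓ := Iff.rfl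

theorem isPrime_smul (σ : backMonoid Γ k L) {ℓ : Ideal (integralClosure Γ L)}
    (h : ℓ.IsPrime) : (σ • ℓ).IsPrime :=
  Ideal.IsPrime.comap (backHom σ)

theorem translate_eq_smul (σ : backMonoid Γ k L) (ℓ : Ideal (integralClosure Γ L)) :
    translate (σ : L ≃ₐ[k] L) ℓ = ((σ • ℓ : Ideal _) : Set (integralClosure Γ L)) := by
  ext x
  constructor
  · rintro ⟨y, hy, h⟩
    have : y = backHom σ x := Subtype.ext h
    rw [this] at hy
    exact hy
  · exact fun h => ⟨backHom σ x, h, rfl⟩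

/-- The image of `e` contains `Γ`, so the integral closure is integral over it, and lying over
applies to the image of `Q`. -/
theorem exists_prime_of_ker_le {R : Type*} [CommRing R] (e : R →+* L)
    (he : ∀ r, e r ∈ integralClosure Γ L) (hΓ : ∀ γ : Γ, ∃ r, e r = algebraMap Γ L γ)
    (Q : Ideal R) [hQ : Q.IsPrime] (hker : RingHom.ker e ≤ Q) :
    ∃ ℓ : Ideal (integralClosure Γ L), ℓ.IsPrime ∧
      ∀ r, (⟨e r, he r⟩ : integralClosure Γ L) ∈ ℓ ↔ r ∈ Q := by
  let f : R →+* integralClosure Γ L := e.codRestrict (integralClosure Γ L) he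
  have hkerf : RingHom.ker f ≤ Q := fun r hr => hker (congrArg Subtype.val hr)
  let i : Γ →+* f.range := (algebraMap Γ (integralClosure Γ L)).codRestrict f.range fun γ => by
    obtain ⟨r, hr⟩ := hΓ γ
    exact ⟨r, Subtype.ext hr⟩
  have hint : (f.range.subtype).IsIntegral := by
    refine RingHom.IsIntegral.tower_top i f.range.subtype ?_
    exact fun x => Algebra.IsIntegral.isIntegral (R := Γ) x
  let _ : Algebra f.range (integralClosure Γ L) := f.range.subtype.toAlgebra
  have : Algebra.IsIntegral f.range (integralClosure Γ L) := ⟨hint⟩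
  have hsurj : Function.Surjective f.rangeRestrict := f.rangeRestrict_surjective
  have hker' : RingHom.ker f.rangeRestrict ≤ Q := by
    rw [RingHom.ker_rangeRestrict]; exact hkerf
  have : (Q.map f.rangeRestrict).IsPrime := Ideal.map_isPrime_of_surjective hsurj hker'
  obtain ⟨ℓ, -, hℓ, hcomap⟩ := Ideal.exists_ideal_over_prime_of_isIntegral
    (S := integralClosure Γ L) (Q.map f.rangeRestrict) ⊥ (by
      intro x hx
      have : x = 0 := Subtype.ext hx
      rw [this]; exact zero_mem _)
  refine ⟨ℓ, hℓ, fun r => ?_⟩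
  have h1 : (⟨e r, he r⟩ : integralClosure Γ L) ∈ ℓ ↔
      f.rangeRestrict r ∈ Q.map f.rangeRestrict := by
    rw [← hcomap]; rfl
  rw [h1, ← Ideal.mem_comap, Ideal.comap_map_of_surjective' _ hsurj, sup_eq_left.2 hker']

theorem isMaximal_of_comap {ℓ : Ideal (integralClosure Γ L)} (hℓ : ℓ.IsPrime) {𝔪 : Ideal Γ}
    (h𝔪 : 𝔪.IsMaximal) (h : ℓ.comap (algebraMap Γ (integralClosure Γ L)) = 𝔪) :
    ℓ.IsMaximal :=
  Ideal.isMaximal_of_isIntegral_of_isMaximal_comap ℓ (h ▸ h𝔪)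

/-- The maximal ideals of the integral closure over `𝔪`. -/
def pointsOver (L : Type*) [Field L] [Algebra Γ L] (𝔪 : Ideal Γ) :
    Set (Ideal (integralClosure Γ L)) :=
  {ℓ | ℓ.IsPrime ∧ ℓ.comap (algebraMap Γ (integralClosure Γ L)) = 𝔪}

theorem mem_pointsOver {𝔪 : Ideal Γ} (h𝔪 : 𝔪.IsMaximal) {ℓ : Ideal (integralClosure Γ L)}
    (hℓ : ℓ.IsPrime) (h : ∀ γ ∈ 𝔪, algebraMap Γ (integralClosure Γ L) γ ∈ ℓ) :
    ℓ ∈ pointsOver L 𝔪 :=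
  ⟨hℓ, (h𝔪.eq_of_le (Ideal.IsPrime.comap _).ne_top h).symm⟩

/-- The functions vanishing on `T` form a finite intersection of kernels of evaluations. A prime
containing it contains one of these kernels, so it is a point of the image of that evaluation and
lifts to the integral closure. -/
theorem exists_point_of_pairRing {M : Submonoid (L ≃ₐ[k] L)} (hM : M ≤ backMonoid Γ k L)
    {C : Subring L} (hC : ∀ x ∈ C, x ∈ integralClosure Γ L)
    (hΓ : ∀ γ : Γ, algebraMap Γ L γ ∈ C)
    (Q : Ideal (pairRing M C)) [hQ : Q.IsPrime] (T : Finset M)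
    (hT : ∀ a : pairRing M C, (∀ t ∈ T, (a : M → L) t = 0) → a ∈ Q) :
    ∃ t ∈ T, ∃ ℓ : Ideal (integralClosure Γ L), ℓ.IsPrime ∧
      (∀ y (hy : y ∈ C), (⟨y, hC y hy⟩ : integralClosure Γ L) ∈ ℓ ↔
        (⟨pairFun M 1 y, pairFun_mem_pairRing C.one_mem hy⟩ : pairRing M C) ∈ Q) ∧
      (∀ x (hx : x ∈ C), (⟨x, hC x hx⟩ : integralClosure Γ L) ∈
          (⟨t, hM t.2⟩ : backMonoid Γ k L) • ℓ ↔
        (⟨pairFun M x 1, pairFun_mem_pairRing hx C.one_mem⟩ : pairRing M C) ∈ Q) := by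
  -- Applying `t⁻¹` sends `x t(y)` to `t⁻¹(x) y`, which is integral over `Γ`; the value `x t(y)`
  -- itself need not be.
  let ev (t : M) : pairRing M C →+* L :=
    ((t : L ≃ₐ[k] L).symm : L →+* L).comp ((Pi.evalRingHom (fun _ : M => L) t).comp
      (pairRing M C).subtype)
  have hev (t : M) (a : pairRing M C) : ev t a = (t : L ≃ₐ[k] L).symm ((a : M → L) t) := rfl
  have hle : T.inf (fun t => RingHom.ker (ev t)) ≤ Q := by
    intro a ha
    refine hT a fun t ht => ?_
    have h := Finset.inf_le (f := fun t => RingHom.ker (ev t)) ht ha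
    rw [RingHom.mem_ker, hev] at h
    exact (t : L ≃ₐ[k] L).symm.injective (h.trans (map_zero _).symm)
  obtain ⟨t, ht, hker⟩ := (Ideal.IsPrime.inf_le' hQ).1 hle
  have he (a : pairRing M C) : ev t a ∈ integralClosure Γ L := by
    rw [hev]
    refine pairRing_induction (p := fun a => (t : L ≃ₐ[k] L).symm (a t) ∈ integralClosure Γ L)
      ?_ ?_ ?_ ?_ a.2
    · intro x hx y hy
      rw [pairFun_apply, map_mul, AlgEquiv.symm_apply_apply]
      exact mul_mem (hM t.2 x (hC x hx)) (hC y hy)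
    · simp
    · intro a b ha hb
      rw [Pi.add_apply, map_add]; exact add_mem ha hb
    · intro a ha
      rw [Pi.neg_apply, map_neg]; exact neg_mem ha
  have hright (y : L) (hy : y ∈ C) :
      ev t ⟨pairFun M 1 y, pairFun_mem_pairRing C.one_mem hy⟩ = y := by
    simp [hev, pairFun_apply]
  obtain ⟨ℓ, hℓ, hmem⟩ := exists_prime_of_ker_le (ev t) he
    (fun γ => ⟨_, hright _ (hΓ γ)⟩) Q hker
  refine ⟨t, ht, ℓ, hℓ, fun y hy => ?_, fun x hx => ?_⟩
  · rw [← hmem]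
    simp only [hright y hy]
  · rw [← hmem, mem_smul_ideal]
    have : backHom (⟨t, hM t.2⟩ : backMonoid Γ k L) ⟨x, hC x hx⟩ =
        ⟨ev t ⟨pairFun M x 1, pairFun_mem_pairRing hx C.one_mem⟩, he _⟩ := by
      ext
      simp [hev, pairFun_apply, coe_backHom]
    rw [this]

end Points

/-! ### Fixed points and units of the monoid. -/

section FixedPoints

variable {A X : Type*} [Group A] {E M : Submonoid A} [MulAction E X]

/-- Moving the factors `g` to the right past elements of `M` only conjugates the latter. -/
theorem exists_mul_pow_eq {m g : A} (hm : m ∈ M) (hnorm : ∀ a ∈ M, g * a * g⁻¹ ∈ M) (n : ℕ) :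
    ∃ q ∈ M, (m * g) ^ (n + 1) = m * q * g ^ (n + 1) := by
  induction n with
  | zero => exact ⟨1, M.one_mem, by simp⟩
  | succ n ih =>
    obtain ⟨q, hq, h⟩ := ih
    refine ⟨g * (m * q) * g⁻¹, hnorm _ (M.mul_mem hm hq), ?_⟩
    rw [pow_succ', h, pow_succ' g (n + 1)]
    group

/-- If `m` followed by an element of finite order which normalizes `M` fixes a point with finite
stabilizer in `M`, then `m` is invertible in `M`. -/
theorem inv_mem_of_smul_eq (hME : M ≤ E) {m g : A} (hm : m ∈ M) (hg : g ∈ E)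
    (hnorm : ∀ a ∈ M, g * a * g⁻¹ ∈ M) (hord : IsOfFinOrder g) {y : X}
    (hy : ((⟨m, hME hm⟩ : E) * ⟨g, hg⟩) • y = y)
    (hfin : {a : A | ∃ h : a ∈ M, (⟨a, hME h⟩ : E) • y = y}.Finite) : m⁻¹ ∈ M := by
  -- Once `g` has cancelled, a power of `m g` has the form `m q` with `q ∈ M` and fixes `y`. The
  -- powers of `m q` lie in a finite set, so two of them agree, and cancelling exhibits an inverse
  -- of `m` in `M`.
  obtain ⟨n, hn, hgn⟩ := isOfFinOrder_iff_pow_eq_one.1 hord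
  obtain ⟨n, rfl⟩ := Nat.exists_eq_succ_of_ne_zero hn.ne'
  obtain ⟨q, hq, h⟩ := exists_mul_pow_eq hm hnorm n
  rw [← Nat.succ_eq_add_one, hgn, mul_one] at h
  have hfix (r : ℕ) : (m * q) ^ r ∈ {a : A | ∃ h : a ∈ M, (⟨a, hME h⟩ : E) • y = y} := by
    refine ⟨M.pow_mem (M.mul_mem hm hq) r, ?_⟩
    have : (⟨(m * q) ^ r, hME (M.pow_mem (M.mul_mem hm hq) r)⟩ : E) =
        (((⟨m, hME hm⟩ : E) * ⟨g, hg⟩) ^ n.succ) ^ r := by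
      ext
      simp [h]
    rw [this, ← pow_mul]
    generalize n.succ * r = j
    induction j with
    | zero => simp
    | succ j ih => rw [pow_succ, mul_smul, hy, ih]
  obtain ⟨r, s, hrs, heq⟩ : ∃ r s, r < s ∧ (m * q) ^ r = (m * q) ^ s := by
    by_contra! hcon
    refine Set.infinite_of_injective_forall_mem (f := fun r : ℕ => (m * q) ^ r) ?_ hfix hfin
    intro r s hrs
    by_contra hne
    rcases lt_or_gt_of_ne hne with hlt | hlt
    · exact hcon r s hlt hrs
    · exact hcon s r hlt hrs.symm
  obtain ⟨j, rfl⟩ : ∃ j, s = r + (j + 1) := ⟨s - r - 1, by omega⟩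
  have hone : m * (q * (m * q) ^ j) = 1 := by
    rw [← mul_assoc, ← pow_succ']
    rw [pow_add] at heq
    exact (mul_left_cancel (a := (m * q) ^ r) (by rw [mul_one]; exact heq)).symm
  rw [inv_eq_of_mul_eq_one_right hone]
  exact M.mul_mem hq (M.pow_mem (M.mul_mem hm hq) j)

/-- If `b` is one such element, then `a ↦ b⁻¹ a` carries all of them into the stabilizer of `y`;
this needs `b⁻¹ ∈ M`. -/
theorem finite_units_moving (hME : M ≤ E) {y z : X}
    (hfin : {a : A | ∃ h : a ∈ M, (⟨a, hME h⟩ : E) • y = y}.Finite) :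
    {a : A | a⁻¹ ∈ M ∧ ∃ h : a ∈ M, (⟨a, hME h⟩ : E) • y = z}.Finite := by
  rcases Set.eq_empty_or_nonempty {a : A | a⁻¹ ∈ M ∧ ∃ h : a ∈ M, (⟨a, hME h⟩ : E) • y = z} with
    h | ⟨b, hb', hb, hbz⟩
  · rw [h]; exact Set.finite_empty
  · refine (hfin.image (b * ·)).subset ?_
    rintro a ⟨-, ha, haz⟩
    refine ⟨b⁻¹ * a, ⟨M.mul_mem hb' ha, ?_⟩, by simp⟩
    have h1 : (⟨b⁻¹ * a, hME (M.mul_mem hb' ha)⟩ : E) = ⟨b⁻¹, hME hb'⟩ * ⟨a, hME ha⟩ := rfl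
    rw [h1, mul_smul, haz, ← hbz, smul_smul]
    have h2 : (⟨b⁻¹, hME hb'⟩ : E) * ⟨b, hME hb⟩ = 1 := by ext; simp
    rw [h2, one_smul]

theorem left_inv_mem_of_mul {a b : A} (hb : b ∈ M) (h : (a * b)⁻¹ ∈ M) : a⁻¹ ∈ M := by
  have : a⁻¹ = b * (a * b)⁻¹ := by group
  rw [this]
  exact M.mul_mem hb h

theorem right_inv_mem_of_mul {a b : A} (ha : a ∈ M) (h : (a * b)⁻¹ ∈ M) : b⁻¹ ∈ M := by
  have : b⁻¹ = (a * b)⁻¹ * a := by group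
  rw [this]
  exact M.mul_mem h ha

end FixedPoints

/-! ### Points up to the Galois group. -/

section GaloisPoints

variable {k Γ K L : Type*} [Field k] [CommRing Γ]
  [Field K] [Algebra k K] [Algebra Γ K] [Field L] [Algebra k L] [Algebra Γ L] [Algebra K L]
  [IsScalarTower k K L] [IsScalarTower Γ K L]

theorem restrictScalars_mem_backMonoid (g : L ≃ₐ[K] L) :
    g.restrictScalars k ∈ backMonoid Γ k L := by
  intro x hx
  exact IsIntegral.map (g.symm.restrictScalars Γ) hx

variable (Γ k) in
/-- The Galois group inside the monoid of automorphisms that act on the ideals of the integral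
closure. -/
def galBack (g : L ≃ₐ[K] L) : backMonoid Γ k L :=
  ⟨g.restrictScalars k, restrictScalars_mem_backMonoid g⟩

theorem galBack_mul (g h : L ≃ₐ[K] L) : galBack k Γ (g * h) = galBack k Γ g * galBack k Γ h := rfl

theorem galBack_inv_mul (g : L ≃ₐ[K] L) : galBack k Γ g⁻¹ * galBack k Γ g = 1 := by
  rw [← galBack_mul, inv_mul_cancel]; rfl

variable (Γ K L) in
/-- The elements of `K` that are integral over `Γ`, as a subring of `L`. -/
def baseClosure : Subalgebra Γ L :=
  integralClosure Γ L ⊓ (IsScalarTower.toAlgHom Γ K L).range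

theorem baseClosure_le : baseClosure Γ K L ≤ integralClosure Γ L := inf_le_left

theorem isNoetherian_baseClosure [IsNoetherianRing Γ] [Module.Finite Γ (integralClosure Γ L)] :
    IsNoetherian Γ (baseClosure Γ K L) :=
  isNoetherian_of_injective (Subalgebra.inclusion (baseClosure_le (K := K))).toLinearMap
    (Subalgebra.inclusion_injective (baseClosure_le (K := K)))

/-- The Galois group acts transitively on the points with the same restriction to `K`. -/
theorem exists_galBack_smul_eq [FiniteDimensional K L] [IsGalois K L]
    {ℓ ℓ' : Ideal (integralClosure Γ L)} (hℓ : ℓ.IsPrime) (hℓ' : ℓ'.IsMaximal)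
    (h : ∀ x : integralClosure Γ L, (x : L) ∈ baseClosure Γ K L → (x ∈ ℓ' → x ∈ ℓ)) :
    ∃ g : L ≃ₐ[K] L, galBack k Γ g • ℓ = ℓ' := by
  classical
  have hsub : (ℓ' : Set (integralClosure Γ L)) ⊆
      ⋃ g ∈ ((Finset.univ : Finset (L ≃ₐ[K] L)) : Set (L ≃ₐ[K] L)),
        ((galBack k Γ g • ℓ : Ideal _) : Set _) := by
    intro x hx
    -- The norm of `x` lies in `ℓ'` and in `K`, hence in `ℓ`, so some conjugate of `x` lies in `ℓ`.
    -- Prime avoidance then finds one `g` that serves all `x`.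
    let y : integralClosure Γ L := ∏ g : L ≃ₐ[K] L, backHom (galBack k Γ g) x
    have hy : (y : L) = ∏ g : L ≃ₐ[K] L, g.symm x := by
      exact map_prod (integralClosure Γ L).val _ _
    have hyK : (y : L) ∈ Set.range (algebraMap K L) := by
      rw [IsGalois.mem_range_algebraMap_iff_fixed]
      intro f
      rw [hy, map_prod]
      refine Fintype.prod_equiv (Equiv.mulRight f⁻¹) _ _ fun g => ?_
      rfl
    have hyB : (y : L) ∈ baseClosure Γ K L := ⟨y.2, hyK⟩
    have hyℓ' : y ∈ ℓ' := by
      refine Ideal.mem_of_dvd _ (Finset.dvd_prod_of_mem _ (Finset.mem_univ (1 : L ≃ₐ[K] L))) ?_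
      exact hx
    have hyℓ : y ∈ ℓ := h y hyB hyℓ'
    obtain ⟨g, -, hg⟩ := (Ideal.IsPrime.prod_mem_iff).1 hyℓ
    simp only [Set.mem_iUnion]
    exact ⟨g, Finset.mem_coe.2 (Finset.mem_univ _), hg⟩
  rw [Ideal.subset_union_prime 1 1 (fun g _ _ _ => isPrime_smul _ hℓ)] at hsub
  obtain ⟨g, -, hg⟩ := hsub
  exact ⟨g, (hℓ'.eq_of_le (isPrime_smul _ hℓ).ne_top hg).symm⟩

theorem inv_mem_of_fixed_mul_galBack [FiniteDimensional K L] {M : Submonoid (L ≃ₐ[k] L)}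
    (hM : IsConjClosed K M) (hB : M ≤ backMonoid Γ k L) {m : L ≃ₐ[k] L} (hm : m ∈ M)
    (g : L ≃ₐ[K] L) {ℓ : Ideal (integralClosure Γ L)} (hfin : (stabilizer M ℓ).Finite)
    (h : ((⟨m, hB hm⟩ : backMonoid Γ k L) * galBack k Γ g) • ℓ = ℓ) : m⁻¹ ∈ M := by
  refine inv_mem_of_smul_eq (E := backMonoid Γ k L) hB hm (galBack k Γ g).2 (hM g) ?_ h ?_
  · have := isOfFinOrder_of_finite g
    obtain ⟨n, hn, hgn⟩ := isOfFinOrder_iff_pow_eq_one.1 this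
    refine isOfFinOrder_iff_pow_eq_one.2 ⟨n, hn, ?_⟩
    have hpow (j : ℕ) : ((galBack k Γ g : backMonoid Γ k L) : L ≃ₐ[k] L) ^ j =
        (g ^ j).restrictScalars k := by
      induction j with
      | zero => rfl
      | succ j ih => rw [pow_succ, pow_succ, ih]; rfl
    rw [hpow, hgn]
    rfl
  · refine hfin.subset ?_
    rintro a ⟨ha, hfix⟩
    refine ⟨ha, ?_⟩
    rw [translate_eq_smul (⟨a, hB ha⟩ : backMonoid Γ k L), hfix]

theorem inv_mem_of_fixed {M : Submonoid (L ≃ₐ[k] L)} (hB : M ≤ backMonoid Γ k L)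
    {m : L ≃ₐ[k] L} (hm : m ∈ M) {ℓ : Ideal (integralClosure Γ L)}
    (hfin : (stabilizer M ℓ).Finite) (h : (⟨m, hB hm⟩ : backMonoid Γ k L) • ℓ = ℓ) :
    m⁻¹ ∈ M := by
  refine inv_mem_of_smul_eq (E := backMonoid Γ k L) (g := 1) hB hm (one_mem _) (by simp)
    IsOfFinOrder.one (y := ℓ) ?_ ?_
  · have : (⟨1, one_mem _⟩ : backMonoid Γ k L) = 1 := rfl
    rw [this, mul_one, h]
  · refine hfin.subset ?_
    rintro a ⟨ha, hfix⟩
    refine ⟨ha, ?_⟩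
    rw [translate_eq_smul (⟨a, hB ha⟩ : backMonoid Γ k L), hfix]

/-- An element of `M` with an image of a point in the Galois orbit of the image of this point under
an invertible element of `M` is invertible in `M`. -/
theorem inv_mem_of_same_base [FiniteDimensional K L] [IsGalois K L] {M : Submonoid (L ≃ₐ[k] L)}
    (hM : IsConjClosed K M) (hB : M ≤ backMonoid Γ k L) {t e : L ≃ₐ[k] L} (ht : t ∈ M)
    (he : e ∈ M) (he' : e⁻¹ ∈ M) {ℓ ℓ' : Ideal (integralClosure Γ L)}
    (hℓ : ℓ.IsPrime) (hℓ' : ℓ'.IsMaximal) (hfin : (stabilizer M ℓ).Finite)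
    (htmax : ((⟨t, hB ht⟩ : backMonoid Γ k L) • ℓ').IsMaximal)
    (h : ∀ x : integralClosure Γ L, (x : L) ∈ baseClosure Γ K L → (x ∈ ℓ' ↔ x ∈ ℓ))
    (h' : ∀ x : integralClosure Γ L, (x : L) ∈ baseClosure Γ K L →
      (x ∈ (⟨t, hB ht⟩ : backMonoid Γ k L) • ℓ' ↔ x ∈ (⟨e, hB he⟩ : backMonoid Γ k L) • ℓ)) :
    t⁻¹ ∈ M := by
  obtain ⟨g, hg⟩ := exists_galBack_smul_eq (k := k) hℓ hℓ' fun x hx => (h x hx).1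
  obtain ⟨f, hf⟩ := exists_galBack_smul_eq (k := k)
    (isPrime_smul _ hℓ) htmax fun x hx => (h' x hx).1
  have hτ : conjAut f⁻¹ t ∈ M := hM f⁻¹ t ht
  have hm : e⁻¹ * conjAut f⁻¹ t ∈ M := M.mul_mem he' hτ
  -- From `g ℓ = ℓ'` and `f e ℓ = t ℓ'` it follows that `e⁻¹ f⁻¹ t g` fixes `ℓ`. Writing `f⁻¹ t g =
  -- (f⁻¹ t f)(f⁻¹ g)` separates an element of `M` from a Galois element.
  have hfix : ((⟨e⁻¹ * conjAut f⁻¹ t, hB hm⟩ : backMonoid Γ k L) * galBack k Γ (f⁻¹ * g)) • ℓ =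
      ℓ := by
    have h1 : (⟨e⁻¹ * conjAut f⁻¹ t, hB hm⟩ : backMonoid Γ k L) * galBack k Γ (f⁻¹ * g) =
        ⟨e⁻¹, hB he'⟩ * (galBack k Γ f⁻¹ * (⟨t, hB ht⟩ * galBack k Γ g)) := by
      ext x
      simp [conjAut, galBack, AlgEquiv.aut_inv]
    rw [h1, mul_smul, mul_smul, mul_smul _ (galBack k Γ g), hg, ← hf, ← mul_smul (galBack k Γ f⁻¹),
      galBack_inv_mul, one_smul, ← mul_smul]
    have h2 : (⟨e⁻¹, hB he'⟩ : backMonoid Γ k L) * ⟨e, hB he⟩ = 1 := by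
      ext x
      simp
    rw [h2, one_smul]
  have h3 := inv_mem_of_fixed_mul_galBack hM hB hm _ hfin hfix
  have h4 : (conjAut f⁻¹ t)⁻¹ ∈ M := right_inv_mem_of_mul he' h3
  have h5 := hM f _ h4
  have h6 : conjAut f (conjAut f⁻¹ t)⁻¹ = t⁻¹ := by
    ext x
    simp [conjAut, AlgEquiv.aut_inv]
  rwa [h6] at h5

end GaloisPoints

/-! ### Finiteness of the integral closure, and the conductor. -/

section Finiteness

/-- By Noether normalization `Γ` is finite over a polynomial ring `A`, which is integrally closed,
and `L` is separable over `Frac A` in characteristic `0`. Integrality over `Γ` and over `A` agree.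
-/
theorem finite_integralClosure (k Γ K L : Type*) [Field k] [CharZero k]
    [CommRing Γ] [IsDomain Γ] [Algebra k Γ] [Algebra.FiniteType k Γ]
    [Field K] [Algebra Γ K] [IsFractionRing Γ K]
    [Field L] [Algebra Γ L] [Algebra K L] [IsScalarTower Γ K L] [FiniteDimensional K L] :
    Module.Finite Γ (integralClosure Γ L) := by
  obtain ⟨s, g, hinj, hfin⟩ := exists_finite_inj_algHom_of_fg k Γ
  let A := MvPolynomial (Fin s) k
  let _ : Algebra A Γ := g.toRingHom.toAlgebra
  have : Module.Finite A Γ := hfin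
  let _ : Algebra A K := ((algebraMap Γ K).comp (algebraMap A Γ)).toAlgebra
  let _ : Algebra A L := ((algebraMap Γ L).comp (algebraMap A Γ)).toAlgebra
  have : IsScalarTower A Γ K := IsScalarTower.of_algebraMap_eq fun _ => rfl
  have : IsScalarTower A Γ L := IsScalarTower.of_algebraMap_eq fun _ => rfl
  have : IsScalarTower A K L := IsScalarTower.of_algebraMap_eq fun x =>
    IsScalarTower.algebraMap_apply Γ K L (algebraMap A Γ x)
  have : FaithfulSMul A Γ := (faithfulSMul_iff_algebraMap_injective A Γ).2 hinj
  have hAK : Function.Injective (algebraMap A K) := (IsFractionRing.injective Γ K).comp hinj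
  have : FaithfulSMul A K := (faithfulSMul_iff_algebraMap_injective A K).2 hAK
  let F := FractionRing A
  let _ : Algebra F K := FractionRing.liftAlgebra A K
  have : IsScalarTower A F K := FractionRing.isScalarTower_liftAlgebra A K
  let _ : Algebra F L := ((algebraMap K L).comp (algebraMap F K)).toAlgebra
  have : IsScalarTower F K L := IsScalarTower.of_algebraMap_eq fun _ => rfl
  have : IsScalarTower A F L := IsScalarTower.of_algebraMap_eq fun x => by
    rw [IsScalarTower.algebraMap_apply A K L, IsScalarTower.algebraMap_apply A F K]
    rfl
  have : Module.Finite F K := Module.Finite.of_isLocalization A Γ (nonZeroDivisors A)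
  have : FiniteDimensional F L := Module.Finite.trans K L
  have : CharZero F := charZero_of_injective_algebraMap
    (R := k) (algebraMap k F).injective
  have : IsNoetherian A (integralClosure A L) :=
    IsIntegralClosure.isNoetherian A F L (integralClosure A L)
  have h : ∀ x : L, x ∈ integralClosure Γ L ↔ x ∈ integralClosure A L := fun x =>
    ⟨fun hx => isIntegral_trans (R := A) (A := Γ) x hx, fun hx => IsIntegral.tower_top hx⟩
  let f : integralClosure Γ L →ₗ[A] integralClosure A L :=
    { toFun := fun x => ⟨x, (h x).1 x.2⟩
      map_add' := fun _ _ => rfl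
      map_smul' := fun a x => by
        ext
        rfl }
  have : IsNoetherian A (integralClosure Γ L) := isNoetherian_of_injective f fun x y hxy =>
    Subtype.ext (congrArg (fun z : integralClosure A L => (z : L)) hxy)
  have : IsScalarTower A Γ (integralClosure Γ L) := inferInstance
  have := Module.IsNoetherian.finite A (integralClosure Γ L)
  exact Module.Finite.of_restrictScalars_finite A Γ (integralClosure Γ L)

theorem finite_pointsOver {Γ L : Type*} [CommRing Γ] [Field L] [Algebra Γ L]
    [Module.Finite Γ (integralClosure Γ L)] (𝔪 : Ideal Γ) :
    (pointsOver L 𝔪).Finite := by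
  refine (Algebra.QuasiFinite.finite_primesOver (S := integralClosure Γ L) 𝔪).subset ?_
  rintro ℓ ⟨h1, h2⟩
  exact ⟨h1, ⟨h2.symm⟩⟩

theorem algebraMap_injective_of_tower (Γ K L : Type*) [CommRing Γ] [Field K] [Algebra Γ K]
    [IsFractionRing Γ K] [Field L] [Algebra Γ L] [Algebra K L] [IsScalarTower Γ K L] :
    Function.Injective (algebraMap Γ L) := by
  rw [IsScalarTower.algebraMap_eq Γ K L]
  exact (algebraMap K L).injective.comp (IsFractionRing.injective Γ K)

/-- `d` is a common denominator of finitely many generators of the `Γ`-module `baseClosure Γ K L`.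
-/
theorem exists_conductor {Γ K L : Type*} [CommRing Γ] [IsDomain Γ] [Field K] [Algebra Γ K]
    [IsFractionRing Γ K] [Field L] [Algebra Γ L] [Algebra K L] [IsScalarTower Γ K L]
    [IsNoetherianRing Γ] [Module.Finite Γ (integralClosure Γ L)] :
    ∃ d : Γ, d ≠ 0 ∧ ∀ x ∈ baseClosure Γ K L, ∃ γ : Γ, algebraMap Γ L d * x = algebraMap Γ L γ := by
  classical
  have := isNoetherian_baseClosure (Γ := Γ) (K := K) (L := L)
  obtain ⟨s, hs⟩ := (Module.IsNoetherian.finite Γ (baseClosure Γ K L)).fg_top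
  have hK (x : baseClosure Γ K L) : ∃ c : K, algebraMap K L c = x := x.2.2
  choose c hc using hK
  obtain ⟨d, hd⟩ := IsLocalization.exist_integer_multiples (nonZeroDivisors Γ) s c
  refine ⟨d, nonZeroDivisors.ne_zero d.2, fun x hx => ?_⟩
  have hmem : (⟨x, hx⟩ : baseClosure Γ K L) ∈ Submodule.span Γ (s : Set (baseClosure Γ K L)) := by
    rw [hs]; trivial
  suffices ∀ y ∈ Submodule.span Γ (s : Set (baseClosure Γ K L)),
      ∃ γ : Γ, algebraMap Γ L d * (y : L) = algebraMap Γ L γ from this _ hmem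
  intro y hy
  induction hy using Submodule.span_induction with
  | mem y hy =>
    obtain ⟨γ, hγ⟩ := hd y hy
    refine ⟨γ, ?_⟩
    rw [← hc y, IsScalarTower.algebraMap_apply Γ K L γ, hγ, Algebra.smul_def, map_mul,
      ← IsScalarTower.algebraMap_apply]
  | zero => exact ⟨0, by simp⟩
  | add y z _ _ hy hz =>
    obtain ⟨γ, hγ⟩ := hy
    obtain ⟨δ, hδ⟩ := hz
    exact ⟨γ + δ, by rw [map_add, ← hγ, ← hδ]; push_cast; ring⟩
  | smul a y _ hy =>
    obtain ⟨γ, hγ⟩ := hy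
    refine ⟨a * γ, ?_⟩
    rw [map_mul, ← hγ, Subalgebra.coe_smul, Algebra.smul_def]
    ring

end Finiteness

/-! ### Right modules in terms of right coefficients. -/

section RightSpans

variable {k L : Type*} [Field k] [Field L] [Algebra k L] {M : Submonoid (L ≃ₐ[k] L)}

theorem coeffHom_apply (A : Type*) [CommRing A] [Algebra A L] (a : A) :
    coeffHom A M a = SkewMonoidAlgebra.single 1 (algebraMap A L a) := rfl

theorem rightCoeff_mul_coeffHom {A : Type*} [CommRing A] [Algebra A L]
    (w : SkewMonoidAlgebra L M) (a : A) : rightCoeff (w * coeffHom A M a) = a • rightCoeff w := by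
  rw [coeffHom_apply, rightCoeff_mul_coe, algebraMap_smul]

theorem mem_rightSpan_iff {A : Type*} [CommRing A] [Algebra A L]
    (s : Set (SkewMonoidAlgebra L M)) (w : SkewMonoidAlgebra L M) :
    w ∈ rightSpan (coeffRing A M) s ↔ rightCoeff w ∈ Submodule.span A (rightCoeff '' s) := by
  constructor
  · intro hw
    refine AddSubgroup.closure_induction
      (p := fun w _ => rightCoeff w ∈ Submodule.span A (rightCoeff '' s)) ?_ ?_ ?_ ?_ hw
    · rintro _ ⟨y, hy, _, ⟨a, rfl⟩, rfl⟩
      rw [rightCoeff_mul_coeffHom]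
      exact Submodule.smul_mem _ _ (Submodule.subset_span ⟨y, hy, rfl⟩)
    · rw [map_zero]; exact zero_mem _
    · intro v w _ _ hv hw
      rw [map_add]; exact add_mem hv hw
    · intro w _ hw
      rw [map_neg]; exact neg_mem hw
  · intro hw
    suffices ∀ f ∈ Submodule.span A (rightCoeff '' s),
        ∃ v ∈ rightSpan (coeffRing A M) s, rightCoeff v = f by
      obtain ⟨v, hv, h⟩ := this _ hw
      rwa [← rightCoeff_injective h]
    intro f hf
    refine Submodule.closure_induction (p := fun f _ =>
      ∃ v ∈ rightSpan (coeffRing A M) s, rightCoeff v = f) ?_ ?_ ?_ hf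
    · exact ⟨0, zero_mem _, map_zero _⟩
    · rintro f g - - ⟨v, hv, rfl⟩ ⟨w, hw, rfl⟩
      exact ⟨v + w, add_mem hv hw, map_add _ _ _⟩
    · rintro a _ ⟨y, hy, rfl⟩
      exact ⟨y * coeffHom A M a, AddSubgroup.subset_closure ⟨y, hy, _, ⟨a, rfl⟩, rfl⟩,
        rightCoeff_mul_coeffHom _ _⟩

theorem mem_rightSpan_finset {A : Type*} [CommRing A] [Algebra A L]
    {s : Finset (SkewMonoidAlgebra L M)} {w : SkewMonoidAlgebra L M}
    (hw : w ∈ rightSpan (coeffRing A M) (s : Set (SkewMonoidAlgebra L M))) :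
    ∃ c : SkewMonoidAlgebra L M → A, w = ∑ y ∈ s, y * coeffHom A M (c y) := by
  classical
  refine AddSubgroup.closure_induction (p := fun w _ =>
    ∃ c : SkewMonoidAlgebra L M → A, w = ∑ y ∈ s, y * coeffHom A M (c y)) ?_ ?_ ?_ ?_ hw
  · rintro _ ⟨y, hy, _, ⟨a, rfl⟩, rfl⟩
    refine ⟨Pi.single y a, ?_⟩
    rw [Finset.sum_eq_single y]
    · rw [Pi.single_eq_same]
    · intro z _ hz
      rw [Pi.single_eq_of_ne hz, map_zero, mul_zero]
    · exact fun h => absurd hy h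
  · exact ⟨0, by simp⟩
  · rintro _ _ - - ⟨c, rfl⟩ ⟨d, rfl⟩
    exact ⟨c + d, by simp [mul_add, Finset.sum_add_distrib]⟩
  · rintro _ - ⟨c, rfl⟩
    exact ⟨-c, by simp⟩

/-- A right submodule of the skew monoid ring, as a submodule of the space of functions. -/
noncomputable def rightModule (A : Type*) [CommRing A] [Algebra A L]
    (N : AddSubgroup (SkewMonoidAlgebra L M))
    (hN : ∀ w ∈ N, ∀ a : A, w * coeffHom A M a ∈ N) : Submodule A (M → L) where
  __ := N.map rightCoeff
  smul_mem' := by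
    rintro a _ ⟨w, hw, rfl⟩
    exact ⟨w * coeffHom A M a, hN w hw a, rightCoeff_mul_coeffHom w a⟩

theorem mem_rightModule {A : Type*} [CommRing A] [Algebra A L]
    {N : AddSubgroup (SkewMonoidAlgebra L M)}
    {hN : ∀ w ∈ N, ∀ a : A, w * coeffHom A M a ∈ N} {w : SkewMonoidAlgebra L M} :
    rightCoeff w ∈ rightModule A N hN ↔ w ∈ N := by
  constructor
  · rintro ⟨v, hv, h⟩
    rwa [← rightCoeff_injective h]
  · exact fun h => ⟨w, h, rfl⟩

theorem exists_finset_of_rightModule_fg {A : Type*} [CommRing A] [Algebra A L]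
    {N : AddSubgroup (SkewMonoidAlgebra L M)}
    {hN : ∀ w ∈ N, ∀ a : A, w * coeffHom A M a ∈ N} (h : (rightModule A N hN).FG) :
    ∃ s : Finset (SkewMonoidAlgebra L M), (s : Set (SkewMonoidAlgebra L M)) ⊆ N ∧
      ∀ w ∈ N, w ∈ rightSpan (coeffRing A M) (s : Set (SkewMonoidAlgebra L M)) := by
  classical
  obtain ⟨t, ht⟩ := h
  have hex : ∀ f ∈ t, ∃ w ∈ N, rightCoeff w = f := fun f hf =>
    (show f ∈ rightModule A N hN from ht ▸ Submodule.subset_span hf)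
  choose! p hp hp' using hex
  refine ⟨t.image p, ?_, fun w hw => ?_⟩
  · intro w hw
    obtain ⟨f, hf, rfl⟩ := Finset.mem_image.1 (Finset.mem_coe.1 hw)
    exact hp f hf
  · rw [mem_rightSpan_iff]
    have h1 : rightCoeff w ∈ Submodule.span A (t : Set (M → L)) := by
      rw [ht]; exact mem_rightModule.2 hw
    refine Submodule.span_mono ?_ h1
    intro f hf
    exact ⟨p f, Finset.mem_coe.2 (Finset.mem_image_of_mem p hf), hp' f hf⟩

/-- The elements of a subgroup with support in `S`. -/
noncomputable def supportedIn (N : AddSubgroup (SkewMonoidAlgebra L M)) (S : Set M) :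
    AddSubgroup (SkewMonoidAlgebra L M) where
  carrier := {w | w ∈ N ∧ ∀ t ∉ S, w.coeff t = 0}
  zero_mem' := ⟨zero_mem _, fun _ _ => rfl⟩
  add_mem' := by
    rintro v w ⟨hv, hv'⟩ ⟨hw, hw'⟩
    exact ⟨add_mem hv hw, fun t ht => by simp [hv' t ht, hw' t ht]⟩
  neg_mem' := by
    rintro v ⟨hv, hv'⟩
    exact ⟨neg_mem hv, fun t ht => by simp [hv' t ht]⟩

theorem mul_coeffHom_mem_supportedIn {A : Type*} [CommRing A] [Algebra A L]
    {N : AddSubgroup (SkewMonoidAlgebra L M)} (hN : ∀ w ∈ N, ∀ a : A, w * coeffHom A M a ∈ N)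
    (S : Set M) : ∀ w ∈ supportedIn N S, ∀ a : A, w * coeffHom A M a ∈ supportedIn N S := by
  rintro w ⟨hw, hw'⟩ a
  refine ⟨hN w hw a, fun t ht => ?_⟩
  rw [coeffHom_apply, coeff_mul_coe, hw' t ht, zero_mul]

end RightSpans

theorem fg_of_le {A V : Type*} [CommRing A] [IsNoetherianRing A] [AddCommGroup V] [Module A V]
    {N N' : Submodule A V} (h : N ≤ N') (h' : N'.FG) : N.FG := by
  have : Module.Finite A N' := Module.Finite.iff_fg.2 h'
  have : IsNoetherian A N' := isNoetherian_of_isNoetherianRing_of_finite A N'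
  have := isNoetherian_of_le h
  exact Module.Finite.iff_fg.1 (Module.IsNoetherian.finite A N)

/-! ### Invariants with prescribed support. -/

section Invariants

variable {k K L : Type*} [Field k] [Field K] [Field L]
  [Algebra k K] [Algebra k L] [Algebra K L] [IsScalarTower k K L]
  {M : Submonoid (L ≃ₐ[k] L)} {hM : IsConjClosed K M}

theorem coeffHom_mem_invariants (c : K) : coeffHom K M c ∈ invariants hM := by
  intro g
  rw [coeffHom_apply, galAct_single]
  congr 1
  · ext1
    simp [conjAut]
  · exact g.commutes c

/-- Right coefficients embed the invariants supported in `S` into `S → L`, which is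
finite-dimensional over `K`. The order condition thereby becomes applicable to a finite support. -/
theorem exists_finset_rightSpan_invariants [FiniteDimensional K L] (hM : IsConjClosed K M)
    (S : Set M) (hS : S.Finite) :
    ∃ s : Finset (SkewMonoidAlgebra L M), (s : Set (SkewMonoidAlgebra L M)) ⊆ invariants hM ∧
      ∀ w ∈ invariants hM, (∀ t ∉ S, w.coeff t = 0) →
        w ∈ rightSpan (coeffRing K M) (s : Set (SkewMonoidAlgebra L M)) := by
  have hN : ∀ w ∈ (invariants hM).toAddSubgroup, ∀ a : K,
      w * coeffHom K M a ∈ (invariants hM).toAddSubgroup := fun w hw a =>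
    (invariants hM).mul_mem hw (coeffHom_mem_invariants a)
  let V := rightModule K (supportedIn (invariants hM).toAddSubgroup S)
    (mul_coeffHom_mem_supportedIn hN S)
  have := hS.to_subtype
  let f : V →ₗ[K] (S → L) := (LinearMap.funLeft K L (Subtype.val : S → M)).comp V.subtype
  have hf : Function.Injective f := by
    rintro ⟨_, v, hv, rfl⟩ ⟨_, w, hw, rfl⟩ h
    ext t
    by_cases ht : t ∈ S
    · exact congrFun h ⟨t, ht⟩
    · change rightCoeff v t = rightCoeff w t
      rw [rightCoeff_apply, rightCoeff_apply, hv.2 t ht, hw.2 t ht]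
  have hfin : Module.Finite K V := Module.Finite.of_injective f hf
  obtain ⟨s, hs, h⟩ := exists_finset_of_rightModule_fg (Module.Finite.iff_fg.1 hfin)
  exact ⟨s, fun w hw => (hs hw).1, fun w hw hw' => h w ⟨hw, hw'⟩⟩

theorem galAct_galAct (g h : L ≃ₐ[K] L) (w : SkewMonoidAlgebra L M) :
    galAct hM g (galAct hM h w) = galAct hM (g * h) w := by
  induction w using SkewMonoidAlgebra.induction_on with
  | zero => simp
  | add v w hv hw => simp [hv, hw]
  | single t a =>
    simp only [galAct_single]
    congr 1

/-- The Galois trace of `t` works: its coefficient at `t` counts the `g` that commute with `t`, a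
positive integer because `g = 1` does, hence nonzero in characteristic `0`. -/
theorem exists_invariant_coeff_ne_zero [CharZero L] [FiniteDimensional K L]
    (hM : IsConjClosed K M) (t : M) : ∃ w ∈ invariants hM, w.coeff t ≠ 0 := by
  classical
  refine ⟨∑ g : L ≃ₐ[K] L, galAct hM g (SkewMonoidAlgebra.single t 1), fun h => ?_, ?_⟩
  · rw [map_sum]
    simp only [galAct_galAct]
    exact Fintype.sum_equiv (Equiv.mulLeft h) _ _ fun g => rfl
  · have h1 : (∑ g : L ≃ₐ[K] L, galAct hM g (SkewMonoidAlgebra.single t 1)).coeff t =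
        ∑ g : L ≃ₐ[K] L, if (⟨conjAut g t, hM g t t.2⟩ : M) = t then (1 : L) else 0 := by
      have h2 : ∀ s : Finset (L ≃ₐ[K] L),
          (∑ g ∈ s, galAct hM g (SkewMonoidAlgebra.single t 1)).coeff t =
          ∑ g ∈ s, (galAct hM g (SkewMonoidAlgebra.single t 1)).coeff t := fun s => by
        induction s using Finset.induction_on with
        | empty => simp
        | insert a s ha ih =>
          rw [Finset.sum_insert ha, Finset.sum_insert ha, SkewMonoidAlgebra.coeff_add,
            Finsupp.add_apply, ih]
      rw [h2]
      refine Finset.sum_congr rfl fun g _ => ?_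
      rw [galAct_single, SkewMonoidAlgebra.coeff_single_apply, map_one]
    rw [h1, Finset.sum_boole]
    refine Nat.cast_ne_zero.2 (Finset.card_ne_zero_of_mem (a := 1) ?_)
    simp only [Finset.mem_filter, Finset.mem_univ, true_and]
    ext x
    rfl

end Invariants

/-! ### Consequences of the right order condition. -/

section RightOrder

variable {k Γ K L : Type*} [Field k] [CommRing Γ]
  [Field K] [Algebra k K] [Field L] [Algebra k L] [Algebra Γ L] [Algebra K L]
  [IsScalarTower k K L]
  {M : Submonoid (L ≃ₐ[k] L)} {hM : IsConjClosed K M} {U : Subring (SkewMonoidAlgebra L M)}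

theorem IsGaloisRing.coeffHom_mem (hU : IsGaloisRing Γ hM U) (γ : Γ) : coeffHom Γ M γ ∈ U :=
  (hU.incl γ).2

theorem IsGaloisRing.scale_mem (hU : IsGaloisRing Γ hM U) {a : M → L}
    (ha : a ∈ pairRing M (algebraMap Γ L).range) {u : SkewMonoidAlgebra L M} (hu : u ∈ U) :
    scale a u ∈ U := by
  refine GaloisOrder.scale_mem (U := U.toAddSubgroup) ?_ ha
  rintro _ ⟨x, rfl⟩ _ ⟨y, rfl⟩
  exact U.mul_mem (U.mul_mem (hU.coeffHom_mem x) hu) (hU.coeffHom_mem y)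

theorem IsGaloisRing.exists_coeff_ne_zero [CharZero L] [FiniteDimensional K L]
    (hU : IsGaloisRing Γ hM U) (t : M) : ∃ u ∈ U, u.coeff t ≠ 0 := by
  by_contra! hcon
  obtain ⟨w, hw, hne⟩ := exists_invariant_coeff_ne_zero hM t
  refine hne ?_
  have hw' : w ∈ leftSpan (coeffRing K M) (U : Set (SkewMonoidAlgebra L M)) := by
    rw [hU.left_span]; exact hw
  refine AddSubgroup.closure_induction (p := fun w _ => w.coeff t = 0) ?_ ?_ ?_ ?_ hw'
  · rintro _ ⟨_, ⟨c, rfl⟩, u, hu, rfl⟩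
    rw [coeffHom_apply, SkewMonoidAlgebra.coeff_single_one_mul, hcon u hu, mul_zero]
  · rfl
  · intro v w _ _ hv hw
    simp [hv, hw]
  · intro w _ hw
    simp [hw]

theorem IsRightOrder.exists_finset [FiniteDimensional K L] (hR : IsRightOrder Γ hM U)
    (hU : IsGaloisRing Γ hM U) {S : Set M} (hS : S.Finite) :
    ∃ t : Finset (SkewMonoidAlgebra L M), (t : Set (SkewMonoidAlgebra L M)) ⊆ U ∧
      ∀ u ∈ U, (∀ t ∉ S, u.coeff t = 0) →
        u ∈ rightSpan (coeffRing Γ M) (t : Set (SkewMonoidAlgebra L M)) := by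
  obtain ⟨s, hs, h⟩ := exists_finset_rightSpan_invariants hM S hS
  obtain ⟨t, ht⟩ := hR s hs
  refine ⟨t, fun x hx => ?_, fun u hu hu' => ?_⟩
  · have hx' : x ∈ rightSpan (coeffRing Γ M) (t : Set (SkewMonoidAlgebra L M)) :=
      AddSubgroup.subset_closure ⟨x, hx, 1, Subring.one_mem _, (mul_one x).symm⟩
    rw [← ht] at hx'
    exact hx'.2
  · rw [← ht]
    exact ⟨h u (hU.le_invariants hu) hu', hu⟩

theorem IsGaloisRing.mul_coeffHom_mem (hU : IsGaloisRing Γ hM U) :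
    ∀ w ∈ U.toAddSubgroup, ∀ a : Γ, w * coeffHom Γ M a ∈ U.toAddSubgroup :=
  fun _ hw a => U.mul_mem hw (hU.coeffHom_mem a)

theorem IsRightOrder.fg_rightModule [IsNoetherianRing Γ] [FiniteDimensional K L]
    (hR : IsRightOrder Γ hM U) (hU : IsGaloisRing Γ hM U) {S : Set M} (hS : S.Finite) :
    (rightModule Γ (supportedIn U.toAddSubgroup S)
      (mul_coeffHom_mem_supportedIn hU.mul_coeffHom_mem S)).FG := by
  classical
  obtain ⟨t, -, h⟩ := hR.exists_finset hU hS
  refine fg_of_le (N' := Submodule.span Γ (rightCoeff '' (t : Set (SkewMonoidAlgebra L M)))) ?_ ?_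
  · rintro _ ⟨w, hw, rfl⟩
    exact (mem_rightSpan_iff _ _).1 (h w hw.1 hw.2)
  · exact Submodule.fg_span (t.finite_toSet.image _)

/-- If `U` is a right Galois order, then the inverses of the elements of `M` preserve
integrality over `Γ`. -/
theorem IsRightOrder.le_backMonoid [IsNoetherianRing Γ] [CharZero L] [FiniteDimensional K L]
    (hR : IsRightOrder Γ hM U) (hU : IsGaloisRing Γ hM U) : M ≤ backMonoid Γ k L := by
  intro σ hσ
  let t : M := ⟨σ, hσ⟩
  obtain ⟨u, hu, hne⟩ := hU.exists_coeff_ne_zero t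
  have hfg := hR.fg_rightModule hU u.support.finite_toSet
  set N := rightModule Γ (supportedIn U.toAddSubgroup (u.support : Set M))
      (mul_coeffHom_mem_supportedIn hU.mul_coeffHom_mem _) with hNdef
  let N' : Submodule Γ L := N.map (LinearMap.proj t)
  have hN' : N'.FG := hfg.map _
  have hΓ : ∀ γ : Γ, σ.symm (algebraMap Γ L γ) ∈ integralClosure Γ L := by
    intro γ
    let x := σ.symm (algebraMap Γ L γ)
    -- The elements `γⁿ u` have support in that of `u`, so they lie in one finitely generated right
    -- `Γ`-module. Their right coefficients at `σ` span a nonzero finitely generated module stable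
    -- under `x = σ⁻¹(γ)`, which makes `x` integral.
    let P : Submodule Γ L := Submodule.span Γ (Set.range fun n : ℕ => x ^ n * rightCoeff u t)
    have hP : P ≤ N' := by
      refine Submodule.span_le.2 ?_
      rintro _ ⟨n, rfl⟩
      refine ⟨rightCoeff (coeffHom Γ M (γ ^ n) * u), mem_rightModule.2
        ⟨U.mul_mem (hU.coeffHom_mem _) hu, fun s hs => ?_⟩, ?_⟩
      · rw [coeffHom_apply, SkewMonoidAlgebra.coeff_single_one_mul,
          SkewMonoidAlgebra.notMem_support_iff.1 hs, mul_zero]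
      · change σ.symm ((coeffHom Γ M (γ ^ n) * u).coeff t) = x ^ n * σ.symm (u.coeff t)
        rw [coeffHom_apply, SkewMonoidAlgebra.coeff_single_one_mul, map_mul, map_pow, map_pow]
    refine isIntegral_of_smul_mem_submodule P ?_ (fg_of_le hP hN') x ?_
    · rw [Submodule.ne_bot_iff]
      refine ⟨rightCoeff u t, Submodule.subset_span ⟨0, by simp⟩, ?_⟩
      rw [rightCoeff_apply]
      exact fun h => hne (σ.symm.injective (h.trans (map_zero _).symm))
    · intro n hn
      induction hn using Submodule.span_induction with
      | mem y hy =>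
        obtain ⟨j, rfl⟩ := hy
        exact Submodule.subset_span ⟨j + 1, by simp only [smul_eq_mul]; ring⟩
      | zero => rw [smul_zero]; exact zero_mem _
      | add a b _ _ ha hb => rw [smul_add]; exact add_mem ha hb
      | smul c a _ ha => rw [smul_comm]; exact Submodule.smul_mem _ c ha
  intro y hy
  obtain ⟨p, hp, hroot⟩ := hy
  let f : Γ →+* integralClosure Γ L :=
    ((σ.symm : L →+* L).comp (algebraMap Γ L)).codRestrict (integralClosure Γ L) hΓ
  refine isIntegral_trans (R := Γ) (A := integralClosure Γ L) _ ⟨p.map f, hp.map f, ?_⟩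
  rw [Polynomial.eval₂_map]
  have hf : (algebraMap (integralClosure Γ L) L).comp f =
      (σ.symm : L →+* L).comp (algebraMap Γ L) := by
    ext γ; rfl
  rw [hf]
  have h2 := Polynomial.hom_eval₂ p (algebraMap Γ L) (σ.symm : L →+* L) y
  rw [hroot, map_zero] at h2
  exact h2.symm

end RightOrder

/-! ### A `C`-stable enlargement of `U` with bounded denominators. -/

section Bounded

variable {k L : Type*} [Field k] [Field L] [Algebra k L] {M : Submonoid (L ≃ₐ[k] L)}

/-- The elements which `d · d` moves to `U` together with all their multiples by the functions in
`pairRing M C`. -/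
noncomputable def boundedBy (U : AddSubgroup (SkewMonoidAlgebra L M)) (C : Subring L) (d : L) :
    AddSubgroup (SkewMonoidAlgebra L M) where
  carrier := {w | ∀ a ∈ pairRing M C, scale (pairFun M d d * a) w ∈ U}
  zero_mem' a _ := by rw [map_zero]; exact zero_mem _
  add_mem' hv hw a ha := by rw [map_add]; exact add_mem (hv a ha) (hw a ha)
  neg_mem' hv a ha := by rw [map_neg]; exact neg_mem (hv a ha)

theorem scale_mem_supportedIn_boundedBy {U : AddSubgroup (SkewMonoidAlgebra L M)} {C : Subring L}
    {d : L} {S : Set M} {a : M → L} (ha : a ∈ pairRing M C) {w : SkewMonoidAlgebra L M}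
    (hw : w ∈ supportedIn (boundedBy U C d) S) :
    scale a w ∈ supportedIn (boundedBy U C d) S := by
  refine ⟨fun b hb => ?_, fun t ht => ?_⟩
  · rw [← scale_mul, mul_assoc]
    exact hw.1 _ (mul_mem hb ha)
  · rw [coeff_scale, hw.2 t ht, mul_zero]

theorem mul_coeffHom_mem_boundedBy {U : AddSubgroup (SkewMonoidAlgebra L M)} {C : Subring L}
    {d : L} {A : Type*} [CommRing A] [Algebra A L] (hA : ∀ a : A, algebraMap A L a ∈ C) :
    ∀ w ∈ boundedBy U C d, ∀ a : A, w * coeffHom A M a ∈ boundedBy U C d := by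
  intro w hw a b hb
  have h : w * coeffHom A M a = scale (pairFun M 1 (algebraMap A L a)) w := by
    rw [scale_pairFun, coeffHom_apply]
    change _ = 1 * w * _
    rw [one_mul]
  rw [h, ← scale_mul, mul_assoc]
  exact hw _ (mul_mem hb (pairFun_mem_pairRing C.one_mem (hA a)))

theorem pairFun_mul_mem_pairRing {C D : Subring L} {d : L} (hd : ∀ x ∈ C, d * x ∈ D) {a : M → L}
    (ha : a ∈ pairRing M C) : pairFun M d d * a ∈ pairRing M D := by
  refine pairRing_induction (p := fun a => pairFun M d d * a ∈ pairRing M D) ?_ ?_ ?_ ?_ ha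
  · intro x hx y hy
    rw [pairFun_mul_pairFun]
    exact pairFun_mem_pairRing (hd x hx) (hd y hy)
  · rw [mul_zero]; exact zero_mem _
  · intro a b ha hb
    rw [mul_add]; exact add_mem ha hb
  · intro a ha
    rw [mul_neg]; exact neg_mem ha

theorem pairRing_apply_one_mem {C : Subring L} {a : M → L} (ha : a ∈ pairRing M C) : a 1 ∈ C := by
  refine pairRing_induction (p := fun a => a 1 ∈ C) ?_ C.zero_mem (fun _ _ => C.add_mem)
    (fun _ => C.neg_mem) ha
  intro x hx y hy
  exact C.mul_mem hx hy

/-- Scaling by `d t(d)` maps the enlarged module back into `U`. On right coefficients it is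
multiplication by the nonzero function `t⁻¹(d) d`, hence injective and `Γ`-linear, and `Γ` is
Noetherian. -/
theorem fg_rightModule_boundedBy {Γ : Type*} [CommRing Γ] [IsNoetherianRing Γ] [Algebra Γ L]
    {U : AddSubgroup (SkewMonoidAlgebra L M)} {C : Subring L} {d : L} (hd : d ≠ 0) {S : Set M}
    (hU : ∀ w ∈ U, ∀ a : Γ, w * coeffHom Γ M a ∈ U)
    (hΓ : ∀ γ : Γ, algebraMap Γ L γ ∈ C)
    (hfg : (rightModule Γ (supportedIn U S) (mul_coeffHom_mem_supportedIn hU S)).FG) :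
    (rightModule Γ (supportedIn (boundedBy U C d) S)
      (mul_coeffHom_mem_supportedIn (mul_coeffHom_mem_boundedBy hΓ) S)).FG := by
  let c : M → L := fun t => (t : L ≃ₐ[k] L).symm d * d
  let f : (M → L) →ₗ[Γ] (M → L) := LinearMap.mulLeft Γ c
  have hf : Function.Injective f := by
    intro x y hxy
    funext t
    refine mul_left_cancel₀ (mul_ne_zero (fun h => hd ?_) hd) (congrFun hxy t)
    exact (t : L ≃ₐ[k] L).symm.injective (h.trans (map_zero _).symm)
  refine Submodule.fg_of_fg_map_injective f hf (fg_of_le ?_ hfg)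
  rintro _ ⟨_, ⟨w, hw, rfl⟩, rfl⟩
  refine ⟨scale (pairFun M d d) w, ⟨?_, fun t ht => ?_⟩, ?_⟩
  · have := hw.1 1 (one_mem _)
    rwa [mul_one] at this
  · rw [coeff_scale, hw.2 t ht, mul_zero]
  · funext t
    change (t : L ≃ₐ[k] L).symm ((scale (pairFun M d d) w).coeff t) =
      ((t : L ≃ₐ[k] L).symm d * d) * (t : L ≃ₐ[k] L).symm (w.coeff t)
    rw [coeff_scale, pairFun_apply, map_mul, map_mul, AlgEquiv.symm_apply_apply]

end Bounded

/-! ### Properness of the left ideal generated by `𝔪`. -/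

section LeftIdeals

variable {Γ A : Type*} [CommRing Γ] [Ring A] (φ : Γ →+* A)

theorem leftIdealGen_pow_eq_top {𝔪 : Ideal Γ} (h : leftIdealGen φ 𝔪 = ⊤) (n : ℕ) :
    leftIdealGen φ (𝔪 ^ n) = ⊤ := by
  have key : ∀ n : ℕ, ∀ γ ∈ 𝔪 ^ n, ∀ x ∈ leftIdealGen φ 𝔪,
      x * φ γ ∈ leftIdealGen φ (𝔪 ^ (n + 1)) := by
    intro n γ hγ x hx
    induction hx using Submodule.span_induction with
    | mem x hx =>
      obtain ⟨μ, hμ, rfl⟩ := hx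
      rw [← map_mul]
      refine Submodule.subset_span ⟨_, ?_, rfl⟩
      rw [pow_succ']
      exact Ideal.mul_mem_mul hμ hγ
    | zero => rw [zero_mul]; exact zero_mem _
    | add x y _ _ hx hy => rw [add_mul]; exact add_mem hx hy
    | smul a x _ hx => rw [smul_eq_mul, mul_assoc]; exact Submodule.smul_mem _ a hx
  induction n with
  | zero =>
    rw [pow_zero, eq_top_iff]
    intro x _
    have : (1 : A) ∈ leftIdealGen φ (1 : Ideal Γ) :=
      Submodule.subset_span ⟨1, by simp, map_one φ⟩
    simpa using Submodule.smul_mem _ x this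
  | succ n ih =>
    rw [eq_top_iff, ← ih]
    refine Submodule.span_le.2 ?_
    rintro _ ⟨γ, hγ, rfl⟩
    have := key n γ hγ 1 (h ▸ Submodule.mem_top)
    rwa [one_mul] at this

end LeftIdeals

section Points

variable {k Γ K L : Type*} [Field k] [CommRing Γ]
  [Field K] [Algebra k K] [Algebra Γ K] [Field L] [Algebra k L] [Algebra Γ L] [Algebra K L]
  [IsScalarTower k K L] [IsScalarTower Γ K L]
  {M : Submonoid (L ≃ₐ[k] L)} {hM : IsConjClosed K M} {U : Subring (SkewMonoidAlgebra L M)}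

/-- The invertible elements of `M` that move some point over `𝔪` to a point over `𝔪`. -/
def unitMovers (hB : M ≤ backMonoid Γ k L) (𝔪 : Ideal Γ) : Set M :=
  {t | (t : L ≃ₐ[k] L)⁻¹ ∈ M ∧ ∃ ℓ ∈ pointsOver L 𝔪,
    (⟨t, hB t.2⟩ : backMonoid Γ k L) • ℓ ∈ pointsOver L 𝔪}

theorem finite_unitMovers (hB : M ≤ backMonoid Γ k L) {𝔪 : Ideal Γ}
    (hX : (pointsOver L 𝔪).Finite) (hfin : ∀ ℓ ∈ pointsOver L 𝔪, (stabilizer M ℓ).Finite) :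
    (unitMovers hB 𝔪).Finite := by
  refine Set.Finite.of_finite_image (f := ((↑) : M → L ≃ₐ[k] L)) ?_
    Subtype.val_injective.injOn
  have h : (⋃ ℓ ∈ pointsOver L 𝔪, ⋃ ℓ' ∈ pointsOver L 𝔪, {a : L ≃ₐ[k] L | a⁻¹ ∈ M ∧
      ∃ h : a ∈ M, (⟨a, hB h⟩ : backMonoid Γ k L) • ℓ = ℓ'}).Finite := by
    refine hX.biUnion fun ℓ hℓ => hX.biUnion fun ℓ' _ => finite_units_moving hB ?_
    refine (hfin ℓ hℓ).subset ?_
    rintro a ⟨ha, hfix⟩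
    refine ⟨ha, ?_⟩
    rw [translate_eq_smul (⟨a, hB ha⟩ : backMonoid Γ k L), hfix]
  refine h.subset ?_
  rintro _ ⟨t, ⟨ht, ℓ, hℓ, hℓ'⟩, rfl⟩
  simp only [Set.mem_iUnion]
  exact ⟨ℓ, hℓ, _, hℓ', ht, t.2, rfl⟩

theorem exists_mem_pointsOver (hinj : Function.Injective (algebraMap Γ L)) {𝔪 : Ideal Γ}
    (h𝔪 : 𝔪.IsMaximal) : ∃ ℓ, ℓ ∈ pointsOver L 𝔪 := by
  obtain ⟨ℓ, hℓ, h⟩ := Ideal.exists_ideal_over_maximal_of_isIntegral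
    (S := integralClosure Γ L) 𝔪 (fun γ hγ => by
      have h0 : algebraMap Γ L γ = 0 := congrArg Subtype.val hγ
      rw [← map_zero (algebraMap Γ L)] at h0
      rw [hinj h0]; exact zero_mem _)
  exact ⟨ℓ, hℓ.isPrime, h⟩

theorem one_mem_unitMovers (hB : M ≤ backMonoid Γ k L)
    (hinj : Function.Injective (algebraMap Γ L)) {𝔪 : Ideal Γ} (h𝔪 : 𝔪.IsMaximal) :
    (1 : M) ∈ unitMovers hB 𝔪 := by
  obtain ⟨ℓ, hℓ⟩ := exists_mem_pointsOver hinj h𝔪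
  refine ⟨by simp [M.one_mem], ℓ, hℓ, ?_⟩
  exact (one_smul (backMonoid Γ k L) ℓ).symm ▸ hℓ

theorem mem_boundedBy (hU : IsGaloisRing Γ hM U) {d : Γ}
    (hd : ∀ x ∈ baseClosure Γ K L, ∃ γ : Γ, algebraMap Γ L d * x = algebraMap Γ L γ)
    {u : SkewMonoidAlgebra L M} (hu : u ∈ U) :
    u ∈ boundedBy U.toAddSubgroup (baseClosure Γ K L).toSubring (algebraMap Γ L d) := by
  intro a ha
  refine hU.scale_mem (pairFun_mul_mem_pairRing (C := (baseClosure Γ K L).toSubring) ?_ ha) hu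
  intro x hx
  obtain ⟨γ, hγ⟩ := hd x hx
  exact ⟨γ, hγ.symm⟩

theorem scale_mem_bounded_movers (hU : IsGaloisRing Γ hM U) {d : Γ}
    (hd : ∀ x ∈ baseClosure Γ K L, ∃ γ : Γ, algebraMap Γ L d * x = algebraMap Γ L γ)
    {u : SkewMonoidAlgebra L M} (hu : u ∈ U) {a : M → L}
    (ha : a ∈ pairRing M (baseClosure Γ K L).toSubring) {S : Set M}
    (hS : ∀ t ∉ S, u.coeff t ≠ 0 → a t = 0) :
    scale a u ∈ supportedIn (boundedBy U.toAddSubgroup (baseClosure Γ K L).toSubring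
      (algebraMap Γ L d)) S := by
  refine ⟨(scale_mem_supportedIn_boundedBy (S := Set.univ) ha
    ⟨mem_boundedBy hU hd hu, fun t ht => absurd trivial ht⟩).1, fun t ht => ?_⟩
  rw [coeff_scale]
  by_cases h : u.coeff t = 0
  · rw [h, mul_zero]
  · rw [hS t ht h, zero_mul]

/-- If no such function existed, the prime of functions with value at `1` in `ℓ₀` would contain all
functions vanishing on `T`. Some `t ∈ T` would then send a point to a point, both with the
restriction of `ℓ₀` to `K`, and comparison with the unit `1` would put `t` into `unitMovers`. -/
theorem exists_apply_one_notMem [FiniteDimensional K L] [IsGalois K L] (hM : IsConjClosed K M)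
    (hB : M ≤ backMonoid Γ k L) {𝔪 : Ideal Γ} (h𝔪 : 𝔪.IsMaximal)
    (hfin : ∀ ℓ ∈ pointsOver L 𝔪, (stabilizer M ℓ).Finite)
    {ℓ₀ : Ideal (integralClosure Γ L)} (hℓ₀ : ℓ₀ ∈ pointsOver L 𝔪)
    (T : Finset M) (hT : ∀ t ∈ T, t ∉ unitMovers hB 𝔪) :
    ∃ a ∈ pairRing M (baseClosure Γ K L).toSubring, (∀ t ∈ T, a t = 0) ∧
      ∀ x ∈ ℓ₀, (x : L) ≠ a 1 := by
  by_contra! hcon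
  let C := (baseClosure Γ K L).toSubring
  have hC : ∀ x ∈ C, x ∈ integralClosure Γ L := fun x hx => hx.1
  let ev : pairRing M C →+* integralClosure Γ L :=
    ((Pi.evalRingHom (fun _ : M => L) 1).comp (pairRing M C).subtype).codRestrict
      (integralClosure Γ L) fun a => hC _ (pairRing_apply_one_mem a.2)
  have hprime := hℓ₀.1
  have hQ : (ℓ₀.comap ev).IsPrime := Ideal.IsPrime.comap ev
  obtain ⟨t, ht, ℓ, hℓ, hright, hleft⟩ := exists_point_of_pairRing hB hC
    (fun γ => (baseClosure Γ K L).algebraMap_mem γ) (ℓ₀.comap ev) T (fun a ha => by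
      obtain ⟨x, hx, hxa⟩ := hcon a a.2 ha
      have : ev a = x := Subtype.ext hxa.symm
      rw [Ideal.mem_comap, this]
      exact hx)
  have h1 : ∀ x : integralClosure Γ L, (x : L) ∈ baseClosure Γ K L → (x ∈ ℓ ↔ x ∈ ℓ₀) := by
    intro x hx
    refine (hright x hx).trans ?_
    rw [Ideal.mem_comap]
    have : ev ⟨pairFun M 1 x, pairFun_mem_pairRing C.one_mem hx⟩ = x := by
      ext
      exact one_mul _
    rw [this]
  have h2 : ∀ x : integralClosure Γ L, (x : L) ∈ baseClosure Γ K L →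
      (x ∈ (⟨t, hB t.2⟩ : backMonoid Γ k L) • ℓ ↔ x ∈ ℓ₀) := by
    intro x hx
    refine (hleft x hx).trans ?_
    rw [Ideal.mem_comap]
    have : ev ⟨pairFun M x 1, pairFun_mem_pairRing hx C.one_mem⟩ = x := by
      ext
      change (x : L) * (1 : L ≃ₐ[k] L) 1 = x
      simp
    rw [this]
  have hmem : ∀ ℓ' : Ideal (integralClosure Γ L), ℓ'.IsPrime →
      (∀ x : integralClosure Γ L, (x : L) ∈ baseClosure Γ K L → (x ∈ ℓ' ↔ x ∈ ℓ₀)) →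
      ℓ' ∈ pointsOver L 𝔪 := by
    intro ℓ' hℓ' h
    refine mem_pointsOver h𝔪 hℓ' fun γ hγ => ?_
    refine (h _ ((baseClosure Γ K L).algebraMap_mem γ)).2 ?_
    rw [← hℓ₀.2] at hγ
    exact hγ
  have hm1 := hmem ℓ hℓ h1
  have hm2 := hmem _ (isPrime_smul (⟨t, hB t.2⟩ : backMonoid Γ k L) hℓ) h2
  refine hT t ht ⟨?_, ℓ, hm1, hm2⟩
  refine inv_mem_of_same_base (e := 1) hM hB t.2 M.one_mem (by simp [M.one_mem]) hℓ₀.1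
    (isMaximal_of_comap hℓ h𝔪 hm1.2) (hfin ℓ₀ hℓ₀) (isMaximal_of_comap hm2.1 h𝔪 hm2.2) h1 ?_
  exact h2

/-- If `U𝔪 = U`, the identity lies in `𝔫ⁿ W` for every `n`, where `W` is finitely generated over the
Noetherian ring `C`. Krull's intersection theorem excludes this. -/
theorem leftIdealGen_ne_top [IsNoetherianRing Γ] [FiniteDimensional K L] [IsGalois K L]
    [CharZero L] [Module.Finite Γ (integralClosure Γ L)]
    (hinj : Function.Injective (algebraMap Γ L))
    {d : Γ} (hd0 : d ≠ 0)
    (hd : ∀ x ∈ baseClosure Γ K L, ∃ γ : Γ, algebraMap Γ L d * x = algebraMap Γ L γ)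
    (hU : IsGaloisRing Γ hM U) (hR : IsRightOrder Γ hM U)
    {𝔪 : Ideal Γ} (h𝔪 : 𝔪.IsMaximal) (hX : (pointsOver L 𝔪).Finite)
    (hfin : ∀ ℓ ∈ pointsOver L 𝔪, (stabilizer M ℓ).Finite) :
    leftIdealGen hU.incl 𝔪 ≠ ⊤ := by
  classical
  intro htop
  have hB := hR.le_backMonoid hU
  let S := unitMovers hB 𝔪
  have hS : S.Finite := finite_unitMovers hB hX hfin
  obtain ⟨ℓ₀, hℓ₀⟩ := exists_mem_pointsOver hinj h𝔪
  let C := baseClosure Γ K L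
  let W := supportedIn (boundedBy U.toAddSubgroup C.toSubring (algebraMap Γ L d)) S
  have hd0' : algebraMap Γ L d ≠ 0 := fun h => hd0 (hinj (h.trans (map_zero _).symm))
  have hfgΓ := fg_rightModule_boundedBy (C := C.toSubring) hd0' hU.mul_coeffHom_mem
    (fun γ => C.algebraMap_mem γ) (hR.fg_rightModule hU hS)
  let N := rightModule C W (mul_coeffHom_mem_supportedIn
    (mul_coeffHom_mem_boundedBy (C := C.toSubring) fun a : C => a.2) S)
  -- Generators over `Γ` also generate over the larger ring `C`.
  have hNfg : N.FG := by
    obtain ⟨s, hs⟩ := hfgΓ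
    refine ⟨s, le_antisymm (Submodule.span_le.2 fun x hx => ?_) fun x hx => ?_⟩
    · have : x ∈ Submodule.span Γ (s : Set (M → L)) := Submodule.subset_span hx
      rw [hs] at this
      exact this
    · refine Submodule.span_le_restrictScalars Γ C (s : Set (M → L)) ?_
      rw [hs]
      exact hx
  have hΓC : IsNoetherian Γ C := isNoetherian_baseClosure
  have hCn : IsNoetherianRing C := isNoetherian_of_tower Γ hΓC
  have hNfin : Module.Finite C N := Module.Finite.iff_fg.2 hNfg
  let i : C →ₐ[Γ] integralClosure Γ L :=
    Subalgebra.inclusion baseClosure_le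
  let 𝔫 : Ideal C := ℓ₀.comap i
  have hprime := hℓ₀.1
  have hn𝔪 : 𝔫.comap (algebraMap Γ C) = 𝔪 := hℓ₀.2
  have h𝔫 : 𝔫.IsMaximal := by
    have : Algebra.IsIntegral Γ C := ⟨fun x => (isIntegral_algHom_iff C.val
      Subtype.val_injective).1 x.2.1⟩
    have : 𝔫.IsPrime := Ideal.IsPrime.comap i
    exact Ideal.isMaximal_of_isIntegral_of_isMaximal_comap (R := Γ) 𝔫 (by rw [hn𝔪]; exact h𝔪)
  have hone : (1 : SkewMonoidAlgebra L M) ∈ W := by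
    refine ⟨mem_boundedBy hU hd U.one_mem, fun t ht => ?_⟩
    have hne : t ≠ 1 := fun h => ht (h ▸ one_mem_unitMovers hB hinj h𝔪)
    rw [SkewMonoidAlgebra.coeff_one, Finsupp.single_eq_of_ne hne]
  let e : N := ⟨rightCoeff 1, mem_rightModule.2 hone⟩
  have hpow : ∀ n : ℕ, e ∈ (𝔫 ^ n • ⊤ : Submodule C N) := by
    intro n
    have hmap : (e : M → L) ∈ 𝔫 ^ n • N → e ∈ (𝔫 ^ n • ⊤ : Submodule C N) := by
      intro h
      have h1 : (𝔫 ^ n • ⊤ : Submodule C N).map N.subtype = 𝔫 ^ n • N := by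
        rw [Submodule.map_smul'', Submodule.map_top, Submodule.range_subtype]
      rw [← h1] at h
      obtain ⟨x, hx, hxe⟩ := h
      rwa [← Subtype.ext (a1 := x) (a2 := e) hxe]
    refine hmap ?_
    have h1 : (1 : U) ∈ leftIdealGen hU.incl (𝔪 ^ n) := by
      rw [leftIdealGen_pow_eq_top hU.incl htop n]; trivial
    obtain ⟨l, hl, hsum⟩ := (Finsupp.mem_span_image_iff_linearCombination U).1 h1
    let T : Finset M := (l.support.biUnion fun γ => (l γ : SkewMonoidAlgebra L M).support).filter
      (· ∉ S)
    -- Values at the identity of functions killing all unwanted coefficients in the expression of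
    -- `1` through `𝔪ⁿ`.
    let 𝔞 : Ideal C :=
      { carrier := {c | ∃ a ∈ pairRing M C.toSubring, (∀ t ∈ T, a t = 0) ∧ a 1 = c}
        zero_mem' := ⟨0, zero_mem _, fun _ _ => rfl, rfl⟩
        add_mem' := by
          rintro _ _ ⟨a, ha, ha', h⟩ ⟨b, hb, hb', h'⟩
          exact ⟨a + b, add_mem ha hb, fun t ht => by simp [ha' t ht, hb' t ht], by simp [h, h']⟩
        smul_mem' := by
          rintro c _ ⟨a, ha, ha', h⟩
          refine ⟨pairFun M c 1 * a, mul_mem (pairFun_mem_pairRing c.2 (one_mem _)) ha,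
            fun t ht => by simp [ha' t ht], ?_⟩
          rw [Pi.mul_apply, h, pairFun_apply, map_one, mul_one]
          rfl }
    have h𝔞 : ¬ 𝔞 ≤ 𝔫 := by
      obtain ⟨a, ha, ha', hne⟩ := exists_apply_one_notMem hM hB h𝔪 hfin hℓ₀ T
        (fun t ht => (Finset.mem_filter.1 ht).2)
      intro hle
      have : (⟨a 1, pairRing_apply_one_mem ha⟩ : C) ∈ 𝔫 := hle ⟨a, ha, ha', rfl⟩
      exact hne _ this rfl
    -- `𝔫` is maximal and does not contain `𝔞`. Hence `1 = c + r` with `r ∈ 𝔫ⁿ`, and it remains to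
    -- treat `c • e`, which is obtained by scaling `1` with a function of value `c` at the identity.
    have hsup : 𝔞 ⊔ 𝔫 ^ n = ⊤ := by
      refine Ideal.sup_pow_eq_top ?_
      by_contra hne
      have := h𝔫.eq_of_le hne le_sup_right
      exact h𝔞 (by rw [this]; exact le_sup_left)
    obtain ⟨c, ⟨a, ha, ha', hac⟩, r, hr, hcr⟩ : ∃ c ∈ 𝔞, ∃ r ∈ 𝔫 ^ n, c + r = 1 := by
      have : (1 : C) ∈ 𝔞 ⊔ 𝔫 ^ n := by rw [hsup]; trivial
      exact Submodule.mem_sup.1 this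
    have hdecomp : (e : M → L) = c • (e : M → L) + r • (e : M → L) := by
      rw [← add_smul, hcr, one_smul]
    rw [hdecomp]
    refine add_mem ?_ (Submodule.smul_mem_smul hr e.2)
    have hce : c • (e : M → L) = rightCoeff (scale a 1) := by
      funext t
      change (c : L) * (t : L ≃ₐ[k] L).symm ((1 : SkewMonoidAlgebra L M).coeff t) =
        (t : L ≃ₐ[k] L).symm ((scale a 1).coeff t)
      rw [coeff_scale]
      by_cases ht : t = 1
      · subst ht
        rw [hac, SkewMonoidAlgebra.coeff_one, Finsupp.single_eq_same, mul_one]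
        change (c : L) * (1 : L ≃ₐ[k] L).symm 1 = (1 : L ≃ₐ[k] L).symm c
        rw [map_one, mul_one]
        rfl
      · rw [SkewMonoidAlgebra.coeff_one, Finsupp.single_eq_of_ne ht, mul_zero, map_zero, mul_zero]
    have hone_eq : (1 : SkewMonoidAlgebra L M) =
        ∑ γ ∈ l.support, (l γ : SkewMonoidAlgebra L M) * coeffHom Γ M γ := by
      have := congrArg (Subtype.val : U → SkewMonoidAlgebra L M) hsum
      rw [Finsupp.linearCombination_apply, Finsupp.sum] at this
      refine this.symm.trans ?_
      exact map_sum U.subtype _ _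
    -- Scaling commutes with right multiplication, so each summand becomes an element of `W` times
    -- `γ ∈ 𝔪ⁿ`.
    rw [hce, hone_eq, map_sum, map_sum]
    refine sum_mem fun γ hγ => ?_
    rw [coeffHom_apply, scale_mul_coe, rightCoeff_mul_coe]
    have hγ' : algebraMap Γ C γ ∈ 𝔫 ^ n := by
      have h2 : γ ∈ 𝔪 ^ n := hl hγ
      have h3 : (𝔪 ^ n).map (algebraMap Γ C) ≤ 𝔫 ^ n := by
        rw [Ideal.map_pow]
        exact Ideal.pow_right_mono (Ideal.map_le_iff_le_comap.2 hn𝔪.ge) n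
      exact h3 (Ideal.mem_map_of_mem _ h2)
    refine Submodule.smul_mem_smul (r := algebraMap Γ C γ) hγ' (mem_rightModule.2 ?_)
    refine scale_mem_bounded_movers hU hd (l γ).2 ha fun t ht hne => ha' t ?_
    refine Finset.mem_filter.2 ⟨Finset.mem_biUnion.2 ⟨γ, hγ, ?_⟩, ht⟩
    exact SkewMonoidAlgebra.mem_support_iff.2 hne
  -- Krull gives `r ∈ 𝔫` with `r • e = e`; the coefficient at the identity yields `r = 1`.
  obtain ⟨r, hr⟩ := (Ideal.mem_iInf_smul_pow_eq_bot_iff 𝔫 e).1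
    ((Submodule.mem_iInf _).2 hpow)
  have h1 : (r : C) = 1 := by
    have h2 := congrFun (congrArg Subtype.val hr) 1
    have h3 : (e : M → L) 1 = 1 := by
      change (1 : L ≃ₐ[k] L).symm ((1 : SkewMonoidAlgebra L M).coeff 1) = 1
      rw [SkewMonoidAlgebra.coeff_one, Finsupp.single_eq_same, map_one]
    change ((r : C) : L) * (e : M → L) 1 = (e : M → L) 1 at h2
    rw [h3, mul_one] at h2
    exact Subtype.ext h2
  exact h𝔫.ne_top (𝔫.eq_top_iff_one.2 (h1 ▸ r.2))

end Points

/-! ### Weight decomposition of the quotients `U / I`. -/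

section WeightSpaces

variable {Γ A : Type*} [CommRing Γ] [Ring A] (φ : Γ →+* A) (V : Type*) [AddCommGroup V] [Module A V]

theorem exists_prod_maximal_le (𝔞 : Ideal Γ) [IsArtinianRing (Γ ⧸ 𝔞)] :
    ∃ Z : Multiset (MaximalSpectrum Γ), (Z.map MaximalSpectrum.asIdeal).prod ≤ 𝔞 := by
  obtain ⟨Z, hZ⟩ := PrimeSpectrum.exists_primeSpectrum_prod_le _ (⊥ : Ideal (Γ ⧸ 𝔞))
  let π := Ideal.Quotient.mk 𝔞
  have hπ : Function.Surjective π := Ideal.Quotient.mk_surjective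
  have hmax (P : PrimeSpectrum (Γ ⧸ 𝔞)) : (P.asIdeal.comap π).IsMaximal := by
    have : P.asIdeal.IsMaximal := inferInstance
    exact Ideal.comap_isMaximal_of_surjective π hπ
  refine ⟨Z.map fun P => ⟨P.asIdeal.comap π, hmax P⟩, ?_⟩
  rw [Multiset.map_map]
  have h : ((Z.map (fun P : PrimeSpectrum (Γ ⧸ 𝔞) => P.asIdeal.comap π)).prod).map π ≤ ⊥ := by
    rw [← Ideal.mapHom_apply, map_multiset_prod, Multiset.map_map]
    refine le_of_eq_of_le (congrArg Multiset.prod (Multiset.map_congr rfl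
      fun (P : PrimeSpectrum (Γ ⧸ 𝔞)) _ => ?_)) hZ
    exact Ideal.map_comap_of_surjective π hπ P.asIdeal
  rw [Ideal.map_le_iff_le_comap] at h
  refine le_trans (le_of_eq rfl) (h.trans (le_of_eq ?_))
  rw [← RingHom.ker_eq_comap_bot, Ideal.mk_ker]

/-- The elements that are killed by an ideal coprime to `𝔞`. -/
def coprimeTorsion {Γ : Type*} [CommRing Γ] (V : Type*) [AddCommGroup V] [Module Γ V]
    (𝔞 : Ideal Γ) : Submodule Γ V where
  carrier := {y | ∃ 𝔟 : Ideal Γ, 𝔞 ⊔ 𝔟 = ⊤ ∧ ∀ γ ∈ 𝔟, γ • y = 0}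
  zero_mem' := by
    refine ⟨⊤, by simp, fun γ _ => ?_⟩
    exact smul_zero γ
  add_mem' := by
    rintro y z ⟨𝔟, h, hb⟩ ⟨𝔠, h', hc⟩
    refine ⟨𝔟 * 𝔠, (Ideal.sup_mul_eq_of_coprime_left h).trans h', fun γ hγ => ?_⟩
    obtain ⟨h1, h2⟩ := Ideal.mul_le_inf hγ
    rw [smul_add, hb γ h1, hc γ h2, add_zero]
  smul_mem' := by
    rintro δ y ⟨𝔟, h, hb⟩
    exact ⟨𝔟, h, fun γ hγ => by rw [smul_comm, hb γ hγ, smul_zero]⟩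

/-- Independence holds because a vector killed by `𝔪ⁿ` and by an ideal coprime to `𝔪` is zero. For
spanning, a product of maximal ideals kills each vector, and the coprime powers in it split the
vector into weight components. -/
theorem isInternal_weightSpace [DecidableEq (MaximalSpectrum Γ)]
    (hV : ∀ x : V, ∃ 𝔞 : Ideal Γ, IsArtinianRing (Γ ⧸ 𝔞) ∧ ∀ γ ∈ 𝔞, φ γ • x = 0) :
    DirectSum.IsInternal fun 𝔪 : MaximalSpectrum Γ => weightSpace φ V 𝔪.asIdeal := by
  let _ : Module Γ V := Module.compHom V φ
  let W (𝔪 : MaximalSpectrum Γ) : Submodule Γ V :=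
    { weightSpace φ V 𝔪.asIdeal with
      smul_mem' := by
        rintro γ x ⟨n, hn⟩
        refine ⟨n, fun δ hδ => ?_⟩
        change φ δ • φ γ • x = 0
        rw [smul_smul, ← map_mul, mul_comm, map_mul, mul_smul, hn δ hδ, smul_zero] }
  have hcop {i j : MaximalSpectrum Γ} (hij : i ≠ j) : i.asIdeal ⊔ j.asIdeal = ⊤ :=
    i.isMaximal.coprime_of_ne j.isMaximal fun h => hij (MaximalSpectrum.ext h)
  have hind : iSupIndep W := by
    intro i
    let D : Submodule Γ V := coprimeTorsion V i.asIdeal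
    have hD : ⨆ j, ⨆ (_ : j ≠ i), W j ≤ D := by
      refine iSup₂_le fun j hj => ?_
      rintro x ⟨n, hn⟩
      exact ⟨j.asIdeal ^ n, Ideal.sup_pow_eq_top (hcop hj.symm), hn⟩
    refine Disjoint.mono_right hD (Submodule.disjoint_def.2 ?_)
    rintro x ⟨n, hn⟩ ⟨𝔟, h, hb⟩
    have h1 : (1 : Γ) ∈ i.asIdeal ^ n ⊔ 𝔟 := by
      rw [Ideal.pow_sup_eq_top h]; trivial
    obtain ⟨a, ha, b, hb', hab⟩ := Submodule.mem_sup.1 h1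
    have h2 : (1 : Γ) • x = 0 := by
      rw [← hab, add_smul, hb b hb', add_zero]
      exact hn a ha
    rwa [one_smul] at h2
  have hsup : iSup W = ⊤ := by
    rw [eq_top_iff]
    intro x _
    obtain ⟨𝔞, hart, hx⟩ := hV x
    obtain ⟨Z, hZ⟩ := exists_prod_maximal_le 𝔞
    let p (i : MaximalSpectrum Γ) : Ideal Γ := i.asIdeal ^ Z.count i
    have hp : (Z.toFinset : Set (MaximalSpectrum Γ)).Pairwise fun i j => p i ⊔ p j = ⊤ :=
      fun i _ j _ hij => Ideal.pow_sup_pow_eq_top (hcop hij)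
    have hp' : (Z.toFinset : Set (MaximalSpectrum Γ)).Pairwise fun i j => IsCoprime (p i) (p j) :=
      fun i hi j hj hij => Ideal.isCoprime_iff_sup_eq.2 (hp hi hj hij)
    have hmem : x ∈ Submodule.torsionBySet Γ V ((⨅ i ∈ Z.toFinset, p i : Ideal Γ) : Set Γ) := by
      rw [Submodule.mem_torsionBySet_iff]
      rintro ⟨γ, hγ⟩
      rw [← Ideal.prod_eq_iInf_of_pairwise_isCoprime hp'] at hγ
      refine hx γ (hZ ?_)
      rw [Finset.prod_multiset_map_count]
      exact hγ
    rw [← Submodule.iSup_torsionBySet_ideal_eq_torsionBySet_iInf hp] at hmem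
    refine (iSup₂_le (a := iSup W) fun i _ => ?_ : _ ≤ iSup W) hmem
    refine le_trans ?_ (le_iSup W i)
    intro y hy
    exact ⟨Z.count i, fun γ hγ => (Submodule.mem_torsionBySet_iff _ _).1 hy ⟨γ, hγ⟩⟩
  exact DirectSum.isInternal_submodule_of_iSupIndep_of_iSup_eq_top hind hsup

end WeightSpaces

/-- Nullstellensatz: the residue field is `k`, so `Γ` acts by scalars on vectors killed by `𝔪`. -/
theorem exists_sub_algebraMap_mem {k Γ : Type*} [Field k] [IsAlgClosed k] [CommRing Γ]
    [Algebra k Γ] [Algebra.FiniteType k Γ] {𝔪 : Ideal Γ} (h𝔪 : 𝔪.IsMaximal) (γ : Γ) :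
    ∃ c : k, γ - algebraMap k Γ c ∈ 𝔪 := by
  let _ : Field (Γ ⧸ 𝔪) := Ideal.Quotient.field 𝔪
  have : Module.Finite k (Γ ⧸ 𝔪) := finite_of_finite_type_of_isJacobsonRing k (Γ ⧸ 𝔪)
  have : Algebra.IsIntegral k (Γ ⧸ 𝔪) := inferInstance
  obtain ⟨c, hc⟩ := (IsAlgClosed.algebraMap_bijective_of_isIntegral (k := k) (K := Γ ⧸ 𝔪)).2
    (Ideal.Quotient.mk 𝔪 γ)
  exact ⟨c, Ideal.Quotient.eq.1 hc.symm⟩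

section Scalars

variable {k Γ A : Type*} [Field k] [IsAlgClosed k] [CommRing Γ] [Algebra k Γ]
  [Algebra.FiniteType k Γ] [Ring A] {φ : Γ →+* A}

/-- Moving `Γ` to the right of `u` lets it act on `v` by scalars. Thus `Γ u v` lies in the `k`-span
of the finitely many `y v`, and the annihilator of `u v` has finite codimension. -/
theorem exists_isArtinianRing_quotient (hcent : ∀ (c : k) (a : A),
      φ (algebraMap k Γ c) * a = a * φ (algebraMap k Γ c))
    {𝔪 : Ideal Γ} (h𝔪 : 𝔪.IsMaximal) {V : Type*} [AddCommGroup V] [Module A V] {v : V}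
    (hv : ∀ γ ∈ 𝔪, φ γ • v = 0) (u : A) (t : Finset A) (c : Γ → A → Γ)
    (hc : ∀ γ, φ γ * u = ∑ y ∈ t, y * φ (c γ y)) :
    ∃ 𝔞 : Ideal Γ, IsArtinianRing (Γ ⧸ 𝔞) ∧ ∀ γ ∈ 𝔞, φ γ • (u • v) = 0 := by
  classical
  let _ : Module Γ V := Module.compHom V φ
  let _ : Module k V := Module.compHom V (algebraMap k Γ)
  have hk (a : k) (x : V) : a • x = φ (algebraMap k Γ a) • x := rfl
  have : IsScalarTower k Γ V := ⟨fun a γ x => by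
    change φ (a • γ) • x = φ (algebraMap k Γ a) • φ γ • x
    rw [smul_smul, ← map_mul, Algebra.smul_def]⟩
  let f : Γ →ₗ[Γ] V := LinearMap.toSpanSingleton Γ V (u • v)
  have hf (γ : Γ) : f γ = φ γ • (u • v) := rfl
  let E : Submodule k V := Submodule.span k (t.image (· • v) : Finset V)
  have hrange : LinearMap.range (f.restrictScalars k) ≤ E := by
    rintro _ ⟨γ, rfl⟩
    change f γ ∈ E
    rw [hf, smul_smul, hc, Finset.sum_smul]
    refine sum_mem fun y hy => ?_
    obtain ⟨a, ha⟩ := exists_sub_algebraMap_mem (k := k) h𝔪 (c γ y)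
    have h1 : φ (c γ y) • v = φ (algebraMap k Γ a) • v := by
      rw [← sub_eq_zero, ← sub_smul, ← map_sub]
      exact hv _ ha
    rw [mul_smul, h1, smul_smul, ← hcent, mul_smul]
    exact Submodule.smul_mem E a (Submodule.subset_span
      (Finset.mem_coe.2 (Finset.mem_image_of_mem _ hy)))
  have hEfin : Module.Finite k E := Module.Finite.span_finset k _
  let 𝔞 : Ideal Γ := LinearMap.ker f
  let q : (Γ ⧸ 𝔞) →ₗ[Γ] V := 𝔞.liftQ f le_rfl
  have hq : Function.Injective q := LinearMap.ker_eq_bot.1 (Submodule.ker_liftQ_eq_bot _ _ _ le_rfl)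
  have hqE : ∀ x, q.restrictScalars k x ∈ E := by
    intro x
    obtain ⟨γ, rfl⟩ := Submodule.Quotient.mk_surjective _ x
    exact hrange ⟨γ, rfl⟩
  have hfin : Module.Finite k (Γ ⧸ 𝔞) := Module.Finite.of_injective
    ((q.restrictScalars k).codRestrict E hqE) fun x y hxy => hq (congrArg Subtype.val hxy)
  exact ⟨𝔞, IsArtinianRing.of_finite k (Γ ⧸ 𝔞), fun γ hγ => hγ⟩

end Scalars

section CentralScalars

variable {k Γ K L : Type*} [Field k] [CommRing Γ] [Algebra k Γ]
  [Field K] [Algebra k K] [Field L] [Algebra k L] [Algebra Γ L] [Algebra K L]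
  [IsScalarTower k K L] [IsScalarTower k Γ L]
  {M : Submonoid (L ≃ₐ[k] L)} {hM : IsConjClosed K M} {U : Subring (SkewMonoidAlgebra L M)}

theorem IsGaloisRing.incl_algebraMap_mul_comm (hU : IsGaloisRing Γ hM U) (c : k) (u : U) :
    hU.incl (algebraMap k Γ c) * u = u * hU.incl (algebraMap k Γ c) := by
  ext t
  change (coeffHom Γ M (algebraMap k Γ c) * (u : SkewMonoidAlgebra L M)).coeff t =
    ((u : SkewMonoidAlgebra L M) * coeffHom Γ M (algebraMap k Γ c)).coeff t
  rw [coeffHom_apply, coeff_mul_coe, SkewMonoidAlgebra.coeff_single_one_mul,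
    ← IsScalarTower.algebraMap_apply, AlgEquiv.commutes, mul_comm]

end CentralScalars

section RightOrder

variable {k Γ K L : Type*} [Field k] [IsAlgClosed k] [CommRing Γ] [Algebra k Γ]
  [Algebra.FiniteType k Γ]
  [Field K] [Algebra k K] [Field L] [Algebra k L] [Algebra Γ L] [Algebra K L]
  [IsScalarTower k K L] [IsScalarTower k Γ L]
  {M : Submonoid (L ≃ₐ[k] L)} {hM : IsConjClosed K M} {U : Subring (SkewMonoidAlgebra L M)}

theorem isGelfandTsetlin_quotient [FiniteDimensional K L]
    (hU : IsGaloisRing Γ hM U) (hR : IsRightOrder Γ hM U)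
    {𝔪 : Ideal Γ} (h𝔪 : 𝔪.IsMaximal) (I : Submodule U U) (hI : ∀ γ ∈ 𝔪, hU.incl γ ∈ I) :
    IsGelfandTsetlin hU.incl (U ⧸ I) := by
  classical
  refine ⟨inferInstance, ?_⟩
  refine isInternal_weightSpace hU.incl (U ⧸ I) fun x => ?_
  obtain ⟨u, rfl⟩ := Submodule.Quotient.mk_surjective I x
  let v : U ⧸ I := Submodule.Quotient.mk 1
  have hv (w : U) : (Submodule.Quotient.mk w : U ⧸ I) = w • v := by
    rw [← Submodule.Quotient.mk_smul, smul_eq_mul, mul_one]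
  obtain ⟨t, htU, ht⟩ := hR.exists_finset hU (S := ((u : SkewMonoidAlgebra L M).support : Set M))
    (Finset.finite_toSet _)
  have hex : ∀ γ : Γ, ∃ c : SkewMonoidAlgebra L M → Γ,
      coeffHom Γ M γ * (u : SkewMonoidAlgebra L M) = ∑ y ∈ t, y * coeffHom Γ M (c y) := by
    intro γ
    refine mem_rightSpan_finset (ht _ (U.mul_mem (hU.coeffHom_mem γ) u.2) fun s hs => ?_)
    rw [coeffHom_apply, SkewMonoidAlgebra.coeff_single_one_mul,
      SkewMonoidAlgebra.notMem_support_iff.1 hs, mul_zero]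
  choose c hc using hex
  rw [hv u]
  let incl : t ↪ U := ⟨fun y => ⟨y, htU y.2⟩, fun y z h =>
    Subtype.ext (congrArg (fun w : U => (w : SkewMonoidAlgebra L M)) h)⟩
  refine exists_isArtinianRing_quotient hU.incl_algebraMap_mul_comm h𝔪 (v := v) ?_ u
    (t.attach.map incl) (fun γ y => c γ y) fun γ => ?_
  · intro γ hγ
    rw [← hv]
    exact (Submodule.Quotient.mk_eq_zero I).2 (hI γ hγ)
  · apply Subtype.ext
    rw [Finset.sum_map]
    refine (hc γ).trans ?_
    rw [← Finset.sum_attach]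
    exact (map_sum U.subtype (fun y : t => incl y * hU.incl (c γ (incl y))) t.attach).symm

end RightOrder

/-! ### Elements of `U` without units in their support. -/

section PathOperators

variable {Γ A : Type*} [CommRing Γ] [Ring A]

/-- The product `n z₀ n z₁ ⋯ n zⱼ₋₁`. -/
def pathOp (φ : Γ →+* A) (n : A) : ℕ → (ℕ → Γ) → A
  | 0, _ => 1
  | j + 1, z => n * (φ (z 0) * pathOp φ n j fun i => z (i + 1))

/-- The factors `n` are removed from the right: the inner product is replaced by its value in `Γ`
modulo the left ideal `I`, after which the hypothesis removes the leftmost `n`. -/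
theorem pathOp_sub_mem {φ : Γ →+* A} {n : A} {I : Submodule A A}
    (h : ∀ γ, n * φ γ - φ γ ∈ I) (j : ℕ) (z : ℕ → Γ) :
    pathOp φ n j z - φ (∏ i ∈ Finset.range j, z i) ∈ I := by
  induction j generalizing z with
  | zero => simp [pathOp]
  | succ j ih =>
    rw [pathOp, Finset.prod_range_succ', mul_comm _ (z 0)]
    set p := ∏ i ∈ Finset.range j, z (i + 1)
    have h1 := I.smul_mem (n * φ (z 0)) (ih fun i => z (i + 1))
    have h2 := add_mem h1 (h (z 0 * p))
    convert! h2 using 1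
    rw [smul_eq_mul, map_mul]
    noncomm_ring

end PathOperators

section Paths

variable {k Γ L : Type*} [Field k] [CommRing Γ] [Field L] [Algebra k L] [Algebra Γ L]
  {M : Submonoid (L ≃ₐ[k] L)}

/-- The value `t₁(z₀ t₂(z₁ ⋯ tⱼ(zⱼ₋₁)))` of a sequence along a word in `M`. -/
def pathVal : List M → (ℕ → Γ) → L
  | [], _ => 1
  | t :: w, z => (t : L ≃ₐ[k] L) (algebraMap Γ L (z 0) * pathVal w fun i => z (i + 1))

theorem pathVal_one (w : List M) : pathVal (k := k) w (1 : ℕ → Γ) = (1 : L) := by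
  induction w with
  | nil => rfl
  | cons t w ih =>
    have h : (fun i => (1 : ℕ → Γ) (i + 1)) = 1 := rfl
    rw [pathVal, h, ih]
    simp

theorem pathVal_mul (w : List M) (y z : ℕ → Γ) :
    pathVal (k := k) w (y * z) = (pathVal w y * pathVal w z : L) := by
  induction w generalizing y z with
  | nil => simp [pathVal]
  | cons t w ih =>
    have h : (fun i => (y * z) (i + 1)) = (fun i => y (i + 1)) * fun i => z (i + 1) := rfl
    rw [pathVal, h, ih, pathVal, pathVal, ← map_mul]
    congr 1
    rw [Pi.mul_apply, map_mul]
    ring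

/-- The values of sequences along a word, as a homomorphism. -/
def pathHom (w : List M) : (ℕ → Γ) →* L where
  toFun := pathVal w
  map_one' := pathVal_one w
  map_mul' := pathVal_mul w

theorem pathVal_mulSingle (w : List M) (i : ℕ) (hi : i < w.length) (γ : Γ) :
    pathVal (k := k) w (Pi.mulSingle i γ : ℕ → Γ) =
      (((w.take (i + 1)).prod : M) : L ≃ₐ[k] L) (algebraMap Γ L γ) := by
  induction w generalizing i with
  | nil => simp at hi
  | cons t w ih =>
    rw [pathVal]
    rcases i with _ | i
    · have h : (fun i => (Pi.mulSingle 0 γ : ℕ → Γ) (i + 1)) = 1 := by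
        funext j
        simp
      rw [h, pathVal_one]
      simp
    · have h : (fun j => (Pi.mulSingle (i + 1) γ : ℕ → Γ) (j + 1)) = Pi.mulSingle i γ := by
        funext j
        by_cases hj : j = i
        · subst hj; simp
        · rw [Pi.mulSingle_eq_of_ne hj, Pi.mulSingle_eq_of_ne (by omega)]
      rw [h, ih i (by simpa using hi)]
      simp

open SkewMonoidAlgebra in
-- Expanding `n` over its support splits the operator into words `t₁ ⋯ tⱼ`, and the contribution of
-- a word depends on `z` only through `pathVal`. The left coefficients `x i` are arbitrary since
-- removing a first letter `t` turns `x` into `t⁻¹(x) z₀`.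
theorem sum_pathOp_eq_zero {ι : Type*} (n : SkewMonoidAlgebra L M) (s : Finset ι) (j : ℕ)
    (x : ι → L) (z : ι → ℕ → Γ)
    (h : ∀ w : List M, w.length = j → (∀ t ∈ w, t ∈ n.support) →
      ∑ i ∈ s, x i * pathVal w (z i) = 0) :
    ∑ i ∈ s, single (1 : M) (x i) * pathOp (coeffHom Γ M) n j (z i) = 0 := by
  induction j generalizing x z with
  | zero =>
    have h0 := h [] rfl (by simp)
    simp only [pathVal, mul_one] at h0
    simp only [pathOp, mul_one]
    have := (_root_.map_sum (singleAddHom (1 : M)) x s).symm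
    rw [h0, map_zero] at this
    exact this
  | succ j ih =>
    have hterm (i : ι) : single (1 : M) (x i) * pathOp (coeffHom Γ M) n (j + 1) (z i) =
        ∑ t ∈ n.support, single t (n.coeff t) *
          (single 1 ((t : L ≃ₐ[k] L).symm (x i) * algebraMap Γ L (z i 0)) *
            pathOp (coeffHom Γ M) n j fun m => z i (m + 1)) := by
      rw [pathOp]
      have hn : n = ∑ t ∈ n.support, single t (n.coeff t) := by
        conv_lhs => rw [← sum_single n]
        rw [sum_def']
      conv_lhs => enter [2, 1]; rw [hn]
      rw [Finset.sum_mul, Finset.mul_sum]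
      refine Finset.sum_congr rfl fun t _ => ?_
      rw [coeffHom_apply, ← mul_assoc, ← mul_assoc, ← mul_assoc, single_mul_single,
        single_mul_single, single_mul_single, one_mul, mul_one, one_smul]
      congr 2
      change x i * n.coeff t * (t : L ≃ₐ[k] L) (algebraMap Γ L (z i 0)) =
        n.coeff t * (t : L ≃ₐ[k] L) ((t : L ≃ₐ[k] L).symm (x i) * algebraMap Γ L (z i 0))
      rw [map_mul, AlgEquiv.apply_symm_apply]
      ring
    simp only [hterm]
    rw [Finset.sum_comm]
    refine Finset.sum_eq_zero fun t ht => ?_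
    rw [← Finset.mul_sum, ih, mul_zero]
    intro w hw hw'
    have h1 := h (t :: w) (by simp [hw]) (by
      intro t' ht'
      rcases List.mem_cons.1 ht' with rfl | h'
      · exact ht
      · exact hw' t' h')
    have h2 := congrArg (t : L ≃ₐ[k] L).symm h1
    rw [_root_.map_sum, map_zero] at h2
    rw [← h2]
    refine Finset.sum_congr rfl fun i _ => ?_
    rw [pathVal, map_mul, AlgEquiv.symm_apply_apply]
    ring

variable (Γ) in
/-- The product of the first `j` entries of a sequence. -/
def initialProd (j : ℕ) : (ℕ → Γ) →* Γ where
  toFun z := ∏ i ∈ Finset.range j, z i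
  map_one' := by simp
  map_mul' y z := by simp [Finset.prod_mul_distrib]

/-- A formal combination of sequences killed along every word gives a zero combination of operators,
so by hypothesis it lies in the prime pulled back from `𝔪`. There are finitely many words, and a
prime containing an intersection of finitely many kernels contains one of them. -/
theorem exists_word_ker_le {n : SkewMonoidAlgebra L M} {j : ℕ} {𝔪 : Ideal Γ} (h𝔪 : 𝔪.IsPrime)
    (h : ∀ f : MonoidAlgebra ℤ (ℕ → Γ),
      f.coeff.sum (fun z c => c • pathOp (coeffHom Γ M) n j z) = 0 →
      MonoidAlgebra.lift ℤ Γ (ℕ → Γ) (initialProd Γ j) f ∈ 𝔪) :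
    ∃ w : List M, w.length = j ∧ (∀ t ∈ w, t ∈ n.support) ∧
      ∀ f : MonoidAlgebra ℤ (ℕ → Γ), MonoidAlgebra.lift ℤ L (ℕ → Γ) (pathHom w) f = 0 →
        MonoidAlgebra.lift ℤ Γ (ℕ → Γ) (initialProd Γ j) f ∈ 𝔪 := by
  classical
  have hfin : {w : List M | w.length = j ∧ ∀ t ∈ w, t ∈ n.support}.Finite := by
    refine ((List.finite_length_eq (n.support : Set M) j).image (List.map Subtype.val)).subset ?_
    rintro w ⟨hw, hw'⟩
    refine ⟨w.attach.map fun t : {t // t ∈ w} => (⟨t.1, hw' t.1 t.2⟩ : (n.support : Set M)),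
      by simpa using hw, ?_⟩
    rw [List.map_map]
    exact List.attach_map_subtype_val w
  have hle : hfin.toFinset.inf (fun w => RingHom.ker (MonoidAlgebra.lift ℤ L (ℕ → Γ)
      (pathHom (k := k) w))) ≤
      𝔪.comap (MonoidAlgebra.lift ℤ Γ (ℕ → Γ) (initialProd Γ j)) := by
    intro f hf
    have hf' : ∀ w : List M, w.length = j → (∀ t ∈ w, t ∈ n.support) →
        MonoidAlgebra.lift ℤ L (ℕ → Γ) (pathHom w) f = 0 := fun w hw hw' =>
      Finset.inf_le (f := fun w => RingHom.ker (MonoidAlgebra.lift ℤ L (ℕ → Γ)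
        (pathHom (k := k) w))) (hfin.mem_toFinset.2 ⟨hw, hw'⟩) hf
    refine h f ?_
    have h1 := sum_pathOp_eq_zero n f.coeff.support j
      (fun z => ((f.coeff z : ℤ) : L)) id fun w hw hw' => by
      have := hf' w hw hw'
      rw [MonoidAlgebra.lift_apply] at this
      rw [← this]
      refine Finset.sum_congr rfl fun z _ => ?_
      simp [pathHom]
    rw [← h1]
    refine Finset.sum_congr rfl fun z _ => ?_
    change f.coeff z • pathOp (coeffHom Γ M) n j z = _
    rw [zsmul_eq_mul, SkewMonoidAlgebra.intCast_def]
    rfl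
  have hprime : (𝔪.comap (MonoidAlgebra.lift ℤ Γ (ℕ → Γ) (initialProd Γ j))).IsPrime :=
    Ideal.IsPrime.comap _
  obtain ⟨w, hw, hker⟩ := (Ideal.IsPrime.inf_le' hprime).1 hle
  have hw' := hfin.mem_toFinset.1 hw
  exact ⟨w, hw'.1, hw'.2, fun f hf => hker hf⟩

end Paths

section PathPoints

variable {k Γ L : Type*} [Field k] [CommRing Γ] [Field L] [Algebra k L] [Algebra Γ L]
  {M : Submonoid (L ≃ₐ[k] L)}

theorem symm_pathVal_mem (hB : M ≤ backMonoid Γ k L) (w : List M) (z : ℕ → Γ) :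
    (w.prod : L ≃ₐ[k] L).symm (pathVal w z) ∈ integralClosure Γ L := by
  induction w generalizing z with
  | nil => simp [pathVal]
  | cons t w ih =>
    rw [List.prod_cons, pathVal]
    change (w.prod : L ≃ₐ[k] L).symm ((t : L ≃ₐ[k] L).symm ((t : L ≃ₐ[k] L) _)) ∈ _
    rw [AlgEquiv.symm_apply_apply, map_mul]
    exact mul_mem (hB w.prod.2 _ (algebraMap_mem _ _)) (ih _)

/-- The word determines a path of points over `𝔪`, one for each proper suffix. More letters than
points force a repetition, so a nonempty block of letters fixes a point; the block is a unit, and so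
is its first letter. -/
theorem exists_inv_mem_of_word (hB : M ≤ backMonoid Γ k L) {𝔪 : Ideal Γ} (h𝔪 : 𝔪.IsMaximal)
    (hX : (pointsOver L 𝔪).Finite) (hfin : ∀ ℓ ∈ pointsOver L 𝔪, (stabilizer M ℓ).Finite)
    (w : List M) (hw : hX.toFinset.card < w.length)
    (hker : ∀ f : MonoidAlgebra ℤ (ℕ → Γ), MonoidAlgebra.lift ℤ L (ℕ → Γ) (pathHom w) f = 0 →
        MonoidAlgebra.lift ℤ Γ (ℕ → Γ) (initialProd Γ w.length) f ∈ 𝔪) :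
    ∃ t ∈ w, (t : L ≃ₐ[k] L)⁻¹ ∈ M := by
  classical
  -- Undoing the whole word makes the values integral and turns the prefix in front of each entry
  -- into the inverse of the remaining suffix.
  let e : MonoidAlgebra ℤ (ℕ → Γ) →+* L := ((w.prod : L ≃ₐ[k] L).symm : L →+* L).comp
    (MonoidAlgebra.lift ℤ L (ℕ → Γ) (pathHom w)).toRingHom
  let χ := MonoidAlgebra.lift ℤ Γ (ℕ → Γ) (initialProd Γ w.length)
  have he_of (z : ℕ → Γ) : e (MonoidAlgebra.of ℤ _ z) =
      (w.prod : L ≃ₐ[k] L).symm (pathVal w z) := by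
    change (w.prod : L ≃ₐ[k] L).symm (MonoidAlgebra.lift ℤ L (ℕ → Γ) (pathHom w) _) = _
    rw [MonoidAlgebra.lift_of]
    rfl
  have he : ∀ r, e r ∈ integralClosure Γ L := by
    intro r
    induction r using MonoidAlgebra.induction_on with
    | of z => rw [he_of]; exact symm_pathVal_mem hB w z
    | add f g hf hg => rw [map_add]; exact add_mem hf hg
    | smul c f hf => rw [map_zsmul]; exact zsmul_mem hf c
  have hdrop (i : ℕ) (hi : i < w.length) (γ : Γ) :
      e (MonoidAlgebra.of ℤ _ (Pi.mulSingle i γ)) =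
        ((w.drop (i + 1)).prod : L ≃ₐ[k] L).symm (algebraMap Γ L γ) := by
    rw [he_of, pathVal_mulSingle w i hi]
    have h := congrArg List.prod (List.take_append_drop (i + 1) w)
    rw [List.prod_append] at h
    rw [← h]
    change ((w.drop (i + 1)).prod : L ≃ₐ[k] L).symm (((w.take (i + 1)).prod : L ≃ₐ[k] L).symm _) = _
    rw [AlgEquiv.symm_apply_apply]
  have hχ (i : ℕ) (hi : i < w.length) (γ : Γ) :
      χ (MonoidAlgebra.of ℤ _ (Pi.mulSingle i γ)) = γ := by
    change MonoidAlgebra.lift ℤ Γ (ℕ → Γ) (initialProd Γ w.length) _ = _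
    rw [MonoidAlgebra.lift_of]
    change ∏ m ∈ Finset.range w.length, (Pi.mulSingle i γ : ℕ → Γ) m = γ
    rw [Finset.prod_eq_single i (fun m _ hm => Pi.mulSingle_eq_of_ne hm _)
      (fun h => absurd (Finset.mem_range.2 hi) h), Pi.mulSingle_eq_same]
  have hprime : (𝔪.comap χ).IsPrime := Ideal.IsPrime.comap χ
  -- The last entry of a sequence sees the empty suffix, so the image of `e` contains `Γ`.
  obtain ⟨ℓ, hℓ, hmem⟩ := exists_prime_of_ker_le e he (fun γ => ⟨_, by
    have h := hdrop (w.length - 1) (by omega) γ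
    rw [Nat.sub_add_cancel (by omega), List.drop_length] at h
    exact h⟩) (𝔪.comap χ) fun f hf => hker f
      ((w.prod : L ≃ₐ[k] L).symm.injective (Eq.trans hf (map_zero _).symm))
  let q (i : ℕ) : backMonoid Γ k L := ⟨((w.drop (i + 1)).prod : M), hB (w.drop (i + 1)).prod.2⟩
  have hpt (i : ℕ) (hi : i < w.length) : q i • ℓ ∈ pointsOver L 𝔪 := by
    refine mem_pointsOver h𝔪 (isPrime_smul _ hℓ) fun γ hγ => ?_
    rw [mem_smul_ideal]
    have h1 : backHom (q i) (algebraMap Γ (integralClosure Γ L) γ) =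
        ⟨e (MonoidAlgebra.of ℤ _ (Pi.mulSingle i γ)), he _⟩ :=
      Subtype.ext (hdrop i hi γ).symm
    rw [h1, hmem, Ideal.mem_comap, hχ i hi]
    exact hγ
  obtain ⟨i, hi, i', hi', hne, heq⟩ := Finset.exists_ne_map_eq_of_card_lt_of_maps_to
    (s := Finset.range w.length) (t := hX.toFinset) (f := fun i => q i • ℓ) (by simpa using hw)
    (fun i hi => hX.mem_toFinset.2 (hpt i (Finset.mem_range.1 (by simpa using hi))))
  wlog hlt : i < i' generalizing i i'
  · exact this i' hi' i hi hne.symm heq.symm (by omega)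
  have hi'' := Finset.mem_range.1 hi'
  obtain ⟨t, v, hv⟩ : ∃ t v, (w.drop (i + 1)).take (i' - i) = t :: v := by
    rw [← List.ne_nil_iff_exists_cons]
    intro h
    have := congrArg List.length h
    simp at this
    omega
  have htw : t ∈ w := by
    refine List.drop_subset (i + 1) w (List.take_subset (i' - i) _ ?_)
    rw [hv]
    exact List.mem_cons_self
  refine ⟨t, htw, ?_⟩
  have hfac : w.drop (i + 1) = (t :: v) ++ w.drop (i' + 1) := by
    rw [← hv]
    conv_lhs => rw [← List.take_append_drop (i' - i) (w.drop (i + 1)), List.drop_drop]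
    congr 2
    omega
  let p : M := (t :: v).prod
  have hq : q i = ⟨p, hB p.2⟩ * q i' := by
    ext x
    simp only [q, hfac, List.prod_append]
    rfl
  have hfix : (⟨p, hB p.2⟩ : backMonoid Γ k L) • (q i' • ℓ) = q i' • ℓ := by
    rw [← mul_smul, ← hq]
    exact heq
  have hp := inv_mem_of_fixed hB p.2 (hfin _ (hpt i' hi'')) hfix
  have hpv : (p : L ≃ₐ[k] L) = t * (v.prod : M) := by
    simp [p]
  rw [hpv] at hp
  exact left_inv_mem_of_mul v.prod.2 hp

end PathPoints

section PathOperatorsInSubring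

variable {k Γ K L : Type*} [Field k] [CommRing Γ]
  [Field K] [Algebra k K] [Field L] [Algebra k L] [Algebra Γ L] [Algebra K L]
  [IsScalarTower k K L]
  {M : Submonoid (L ≃ₐ[k] L)} {hM : IsConjClosed K M} {U : Subring (SkewMonoidAlgebra L M)}

theorem IsGaloisRing.coe_pathOp (hU : IsGaloisRing Γ hM U) (n : U) (j : ℕ) (z : ℕ → Γ) :
    ((pathOp hU.incl n j z : U) : SkewMonoidAlgebra L M) = pathOp (coeffHom Γ M) n j z := by
  induction j generalizing z with
  | zero => rfl
  | succ j ih =>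
    rw [pathOp, pathOp, Subring.coe_mul, Subring.coe_mul, ih]
    rfl

end PathOperatorsInSubring

section RightOrder

variable {k Γ K L : Type*} [Field k] [IsAlgClosed k] [CommRing Γ] [Algebra k Γ]
  [Algebra.FiniteType k Γ]
  [Field K] [Algebra k K] [Field L] [Algebra k L] [Algebra Γ L] [Algebra K L]
  [IsScalarTower k K L] [IsScalarTower k Γ L]
  {M : Submonoid (L ≃ₐ[k] L)} {hM : IsConjClosed K M} {U : Subring (SkewMonoidAlgebra L M)}

/-- An element of `U` without invertible elements of `M` in its support lies in all maximal left
ideals of `U` that contain `𝔪`. -/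
theorem IsGaloisRing.mem_of_support (hU : IsGaloisRing Γ hM U) (hB : M ≤ backMonoid Γ k L)
    {𝔪 : Ideal Γ} (h𝔪 : 𝔪.IsMaximal)
    (hX : (pointsOver L 𝔪).Finite) (hfin : ∀ ℓ ∈ pointsOver L 𝔪, (stabilizer M ℓ).Finite)
    {I : Submodule U U} (hI : IsCoatom I) (hI𝔪 : ∀ γ ∈ 𝔪, hU.incl γ ∈ I) {n : U}
    (hn : ∀ t ∈ (n : SkewMonoidAlgebra L M).support, (t : L ≃ₐ[k] L)⁻¹ ∉ M) : n ∈ I := by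
  classical
  by_contra hnI
  have htop : I ⊔ Submodule.span U {n} = ⊤ := hI.2 _ (left_lt_sup.2 fun h =>
    hnI (h (Submodule.mem_span_singleton_self n)))
  obtain ⟨i, hi, x, hx, hix⟩ := Submodule.mem_sup.1
    (htop ▸ Submodule.mem_top : (1 : U) ∈ I ⊔ Submodule.span U {n})
  obtain ⟨u, rfl⟩ := Submodule.mem_span_singleton.1 hx
  -- Maximality of `I` produces a left multiple of `n` congruent to `1` modulo `I`. It still has no
  -- unit in its support, since a right factor of a unit within `M` is a unit.
  set n' : U := u • n with hn'
  have hsub : n' - 1 ∈ I := by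
    rw [← hix, sub_add_cancel_right]
    exact neg_mem hi
  have hsupp : ∀ t ∈ (n' : SkewMonoidAlgebra L M).support, (t : L ≃ₐ[k] L)⁻¹ ∉ M := by
    intro t ht h
    obtain ⟨a, ha, b, hb, rfl⟩ := Finset.mem_mul.1 (SkewMonoidAlgebra.support_mul _ _ ht)
    exact hn b hb (right_inv_mem_of_mul a.2 h)
  have hγ : ∀ γ, n' * hU.incl γ - hU.incl γ ∈ I := by
    intro γ
    obtain ⟨c, hc⟩ := exists_sub_algebraMap_mem (k := k) h𝔪 γ
    have h1 : n' * hU.incl γ - hU.incl γ =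
        hU.incl (algebraMap k Γ c) * (n' - 1) +
          (n' - 1) * hU.incl (γ - algebraMap k Γ c) := by
      have h2 := hU.incl_algebraMap_mul_comm c (n' - 1)
      rw [map_sub, h2]
      noncomm_ring
    rw [h1]
    exact add_mem (I.smul_mem _ hsub) (I.smul_mem _ (hI𝔪 _ hc))
  -- A relation between path operators gives a relation modulo `I` between products in `Γ`. It must
  -- hold modulo `𝔪`, as otherwise `I` would contain `1`. The length exceeds the number of points by
  -- one, for the pigeonhole principle.
  obtain ⟨w, hw, hwn, hker⟩ := exists_word_ker_le (n := (n' : SkewMonoidAlgebra L M))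
    (j := hX.toFinset.card + 1) h𝔪.isPrime (by
      intro f hf
      have h0 : f.coeff.sum (fun z c => c • pathOp hU.incl n' (hX.toFinset.card + 1) z) = 0 := by
        refine Subtype.ext (Eq.trans ?_ hf)
        rw [Finsupp.sum, Finsupp.sum]
        refine (map_sum U.subtype _ _).trans (Finset.sum_congr rfl fun z _ => ?_)
        rw [← hU.coe_pathOp]
        exact map_zsmul U.subtype _ _
      have h1 : hU.incl (MonoidAlgebra.lift ℤ Γ (ℕ → Γ)
          (initialProd Γ (hX.toFinset.card + 1)) f) ∈ I := by
        have h2 : f.coeff.sum (fun z c => c • (pathOp hU.incl n' (hX.toFinset.card + 1) z -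
            hU.incl (initialProd Γ (hX.toFinset.card + 1) z))) ∈ I :=
          sum_mem fun z _ => zsmul_mem (pathOp_sub_mem hγ _ z) _
        simp only [smul_sub] at h2
        rw [Finsupp.sum_sub, h0, zero_sub, neg_mem_iff] at h2
        rw [MonoidAlgebra.lift_apply, Finsupp.sum, map_sum]
        refine (Eq.mp ?_ h2)
        congr 1
        refine Finset.sum_congr rfl fun z _ => ?_
        rw [map_zsmul]
      by_contra hnot
      obtain ⟨y, i, hi, hyi⟩ := h𝔪.exists_inv hnot
      refine hI.1 ((Submodule.eq_top_iff').2 fun v => ?_)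
      have h3 : (1 : U) ∈ I := by
        rw [← map_one hU.incl, ← hyi, map_add, map_mul]
        exact add_mem (I.smul_mem _ h1) (hI𝔪 _ hi)
      simpa using I.smul_mem v h3)
  obtain ⟨t, ht, htM⟩ := exists_inv_mem_of_word hB h𝔪 hX hfin w (by omega) (by rw [hw]; exact hker)
  exact hsupp t (hwn t ht) htM

end RightOrder

/-! ### Independent generators of non-isomorphic simple modules. -/

section Density

variable {A ι : Type*} [Ring A] {I : ι → Submodule A A}

theorem surjective_mkQ_restrict {N J : Submodule A A} (hJ : IsCoatom J) (h : ¬ N ≤ J) :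
    Function.Surjective (J.mkQ ∘ₗ N.subtype) := by
  rw [← LinearMap.range_eq_top, LinearMap.range_comp, Submodule.range_subtype]
  have htop : J ⊔ N = ⊤ := hJ.2 _ (left_lt_sup.2 h)
  rw [eq_top_iff]
  rintro x -
  obtain ⟨a, rfl⟩ := J.mkQ_surjective x
  obtain ⟨b, hb, c, hc, rfl⟩ := Submodule.mem_sup.1 (htop ▸ Submodule.mem_top : a ∈ J ⊔ N)
  refine ⟨c, hc, ?_⟩
  have h0 : J.mkQ b = 0 := (Submodule.Quotient.mk_eq_zero J).2 hb
  rw [map_add, h0, zero_add]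

/-- By induction, `N = s.inf I` surjects onto both `A ⧸ I a` and `A ⧸ I i`. If `I a ⊓ N ≤ I i`, the
second map factors through the first, and Schur's lemma gives a forbidden isomorphism. -/
theorem not_inf_le_of_pairwise (hI : ∀ i, IsCoatom (I i))
    (hne : ∀ i j, i ≠ j → IsEmpty ((A ⧸ I i) ≃ₗ[A] (A ⧸ I j))) (s : Finset ι) (i : ι)
    (hi : i ∉ s) : ¬ s.inf I ≤ I i := by
  classical
  induction s using Finset.induction_on generalizing i with
  | empty => exact fun h => (hI i).1 (top_le_iff.1 h)
  | insert a s has ih =>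
    intro hle
    rw [Finset.inf_insert] at hle
    rw [Finset.mem_insert, not_or] at hi
    set N := s.inf I
    let f := (I a).mkQ ∘ₗ N.subtype
    let g := (I i).mkQ ∘ₗ N.subtype
    have hf : Function.Surjective f := surjective_mkQ_restrict (hI a) (ih a has)
    have hg : Function.Surjective g := surjective_mkQ_restrict (hI i) (ih i hi.2)
    have hker : LinearMap.ker f ≤ LinearMap.ker g := by
      intro x hx
      have h1 : (x : A) ∈ I a := (Submodule.Quotient.mk_eq_zero _).1 hx
      exact (Submodule.Quotient.mk_eq_zero _).2 (hle ⟨h1, x.2⟩)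
    have := isSimpleModule_iff_isCoatom.2 (hI a)
    have := isSimpleModule_iff_isCoatom.2 (hI i)
    let e := f.quotKerEquivOfSurjective hf
    let h : (A ⧸ I a) →ₗ[A] (A ⧸ I i) := (LinearMap.ker f).liftQ g hker ∘ₗ e.symm.toLinearMap
    have hh : h ≠ 0 := by
      intro h0
      have := IsSimpleModule.nontrivial A (A ⧸ I i)
      obtain ⟨y, hy⟩ := exists_ne (0 : A ⧸ I i)
      obtain ⟨x, rfl⟩ := hg y
      refine hy ?_
      have := LinearMap.congr_fun h0 (e (Submodule.Quotient.mk x))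
      simpa [h] using this
    exact (hne a i (Ne.symm hi.1)).false
      (LinearEquiv.ofBijective h (LinearMap.bijective_of_ne_zero hh))

/-- Finitely many pairwise non-isomorphic simple cyclic modules have independent generators. -/
theorem exists_sub_one_mem_of_pairwise [Fintype ι] (hI : ∀ i, IsCoatom (I i))
    (hne : ∀ i j, i ≠ j → IsEmpty ((A ⧸ I i) ≃ₗ[A] (A ⧸ I j))) (i : ι) :
    ∃ u : A, u - 1 ∈ I i ∧ ∀ j ≠ i, u ∈ I j := by
  classical
  have h := not_inf_le_of_pairwise hI hne (Finset.univ.erase i) i (Finset.notMem_erase i _)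
  have htop : I i ⊔ (Finset.univ.erase i).inf I = ⊤ := (hI i).2 _ (left_lt_sup.2 h)
  obtain ⟨a, ha, u, hu, hau⟩ := Submodule.mem_sup.1
    (htop ▸ Submodule.mem_top : (1 : A) ∈ I i ⊔ (Finset.univ.erase i).inf I)
  refine ⟨u, ?_, fun j hj => ?_⟩
  · rw [← hau, sub_add_cancel_right]
    exact neg_mem ha
  · exact Finset.inf_le (f := I) (Finset.mem_erase.2 ⟨hj, Finset.mem_univ j⟩) hu

end Density

/-! ### Splitting off the units modulo `𝔪`. -/

section PairIntegrality

variable {k L : Type*} [Field k] [Field L] [Algebra k L] (M : Submonoid (L ≃ₐ[k] L))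

/-- The constant functions with values in `C`. -/
def leftPair (C : Subring L) : C →+* pairRing M C where
  toFun x := ⟨pairFun M x 1, pairFun_mem_pairRing x.2 C.one_mem⟩
  map_one' := Subtype.ext pairFun_one_one
  map_mul' x y := by ext t; simp [pairFun_apply]
  map_zero' := by ext t; simp [pairFun_apply]
  map_add' x y := by ext t; simp [pairFun_apply]

/-- The functions `t ↦ t(y)` with `y ∈ C`. -/
def rightPair (C : Subring L) : C →+* pairRing M C where
  toFun y := ⟨pairFun M 1 y, pairFun_mem_pairRing C.one_mem y.2⟩
  map_one' := Subtype.ext pairFun_one_one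
  map_mul' x y := by ext t; simp [pairFun_apply]
  map_zero' := by ext t; simp [pairFun_apply]
  map_add' x y := by ext t; simp [pairFun_apply]

/-- The larger ring is generated by the constants `x` and the functions `t ↦ t(y)`, and an integral
equation for `x` or `y` carries over to them. -/
theorem isIntegral_inclusion_pairRing {D C : Subring L} (h : D ≤ C)
    (hint : (Subring.inclusion h).IsIntegral) :
    (Subring.inclusion (pairRing_mono (M := M) h)).IsIntegral := by
  have hl (x : C) : (Subring.inclusion (pairRing_mono (M := M) h)).IsIntegralElem
      (leftPair M C x) := by
    obtain ⟨p, hp, hx⟩ := hint x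
    refine ⟨p.map (leftPair M D), hp.map _, ?_⟩
    rw [Polynomial.eval₂_map]
    have := congrArg (leftPair M C) hx
    rw [Polynomial.hom_eval₂, map_zero] at this
    exact this
  have hr (x : C) : (Subring.inclusion (pairRing_mono (M := M) h)).IsIntegralElem
      (rightPair M C x) := by
    obtain ⟨p, hp, hx⟩ := hint x
    refine ⟨p.map (rightPair M D), hp.map _, ?_⟩
    rw [Polynomial.eval₂_map]
    have := congrArg (rightPair M C) hx
    rw [Polynomial.hom_eval₂, map_zero] at this
    exact this
  rintro ⟨a, ha⟩
  suffices h' : ∃ ha : a ∈ pairRing M C,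
      (Subring.inclusion (pairRing_mono (M := M) h)).IsIntegralElem ⟨a, ha⟩ from h'.2
  refine pairRing_induction (p := fun a => ∃ ha : a ∈ pairRing M C,
    (Subring.inclusion (pairRing_mono (M := M) h)).IsIntegralElem ⟨a, ha⟩) ?_ ?_ ?_ ?_ ha
  · intro x hx y hy
    refine ⟨pairFun_mem_pairRing hx hy, ?_⟩
    have h1 : (⟨pairFun M x y, pairFun_mem_pairRing hx hy⟩ : pairRing M C) =
        leftPair M C ⟨x, hx⟩ * rightPair M C ⟨y, hy⟩ := by
      ext t
      simp [leftPair, rightPair, pairFun_apply]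
    rw [h1]
    exact (hl _).mul _ (hr _)
  · exact ⟨zero_mem _, RingHom.isIntegralElem_zero _⟩
  · rintro a b ⟨ha, ha'⟩ ⟨hb, hb'⟩
    exact ⟨add_mem ha hb, ha'.add _ hb'⟩
  · rintro a ⟨ha, ha'⟩
    exact ⟨neg_mem ha, ha'.neg _⟩

end PairIntegrality

section UnitPart

variable {k L : Type*} [Field k] [Field L] [Algebra k L] {M : Submonoid (L ≃ₐ[k] L)}

open Classical in
/-- The part of `w` that is supported at the invertible elements of `M`. -/
noncomputable def unitPart : SkewMonoidAlgebra L M →+ SkewMonoidAlgebra L M :=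
  scale fun t => if (t : L ≃ₐ[k] L)⁻¹ ∈ M then 1 else 0

theorem coeff_unitPart_of_inv_mem {t : M} (h : (t : L ≃ₐ[k] L)⁻¹ ∈ M)
    (w : SkewMonoidAlgebra L M) : (unitPart w).coeff t = w.coeff t := by
  simp [unitPart, h]

theorem coeff_unitPart_of_inv_notMem {t : M} (h : (t : L ≃ₐ[k] L)⁻¹ ∉ M)
    (w : SkewMonoidAlgebra L M) : (unitPart w).coeff t = 0 := by
  simp [unitPart, h]

theorem unitPart_mul_coe (w : SkewMonoidAlgebra L M) (y : L) :
    unitPart (w * SkewMonoidAlgebra.single 1 y) = unitPart w * SkewMonoidAlgebra.single 1 y :=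
  scale_mul_coe _ _ _

end UnitPart

section Approximation

variable {k Γ K L : Type*} [Field k] [CommRing Γ]
  [Field K] [Algebra k K] [Algebra Γ K] [Field L] [Algebra k L] [Algebra Γ L] [Algebra K L]
  [IsScalarTower k K L] [IsScalarTower Γ K L]
  {M : Submonoid (L ≃ₐ[k] L)} {hM : IsConjClosed K M} {U : Subring (SkewMonoidAlgebra L M)}

variable (Γ M) in
/-- The ideal of the functions `∑ xᵢ t(yᵢ)` with `xᵢ, yᵢ` in the image of `Γ` that is generated by
the elements `x` and `t(x)` with `x ∈ 𝔪`. -/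
def pairIdeal (𝔪 : Ideal Γ) : Ideal (pairRing M (algebraMap Γ L).range) :=
  𝔪.map ((leftPair M _).comp (algebraMap Γ L).rangeRestrict) ⊔
    𝔪.map ((rightPair M _).comp (algebraMap Γ L).rangeRestrict)

/-- If the split failed, lying over would give a prime containing the functions vanishing on `T` and
those vanishing on `E`. It would yield `t ∈ T` and a unit `e ∈ E` moving points over `𝔪` with the
same restrictions to `K` at source and target, so `t` would be a unit and lie in `unitMovers`. -/
theorem exists_split_one_sub [FiniteDimensional K L] [IsGalois K L] (hM : IsConjClosed K M)
    (hB : M ≤ backMonoid Γ k L) {𝔪 : Ideal Γ} (h𝔪 : 𝔪.IsMaximal)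
    (hfin : ∀ ℓ ∈ pointsOver L 𝔪, (stabilizer M ℓ).Finite)
    (T E : Finset M) (hT : ∀ t ∈ T, t ∉ unitMovers hB 𝔪) (hE : ∀ t ∈ E, (t : L ≃ₐ[k] L)⁻¹ ∈ M) :
    ∃ b ∈ pairIdeal Γ M 𝔪, ∃ x ∈ pairRing M (baseClosure Γ K L).toSubring,
      ∃ y ∈ pairRing M (baseClosure Γ K L).toSubring,
      1 + (b : M → L) = x + y ∧ (∀ t ∈ T, x t = 0) ∧ ∀ t ∈ E, y t = 0 := by
  let C := (baseClosure Γ K L).toSubring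
  let D := (algebraMap Γ L).range
  have hDC : D ≤ C := by
    rintro _ ⟨γ, rfl⟩
    exact (baseClosure Γ K L).algebraMap_mem γ
  have hC : ∀ x ∈ C, x ∈ integralClosure Γ L := fun x hx => hx.1
  have hint : (Subring.inclusion hDC).IsIntegral := by
    intro x
    obtain ⟨p, hp, hx⟩ := hC x x.2
    refine ⟨p.map (algebraMap Γ L).rangeRestrict, hp.map _, Subtype.ext ?_⟩
    rw [Polynomial.eval₂_map]
    refine (Polynomial.hom_eval₂ p _ C.subtype x).trans ?_
    exact hx
  let i := Subring.inclusion (pairRing_mono (M := M) hDC)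
  have hi : i.IsIntegral := isIntegral_inclusion_pairRing M hDC hint
  let vanish (S : Finset M) : Ideal (pairRing M C) :=
    { carrier := {a | ∀ t ∈ S, (a : M → L) t = 0}
      zero_mem' := fun _ _ => rfl
      add_mem' := fun {a b} ha hb t ht => by
        change (a : M → L) t + (b : M → L) t = 0
        rw [ha t ht, hb t ht, add_zero]
      smul_mem' := fun c a ha t ht => by
        change (c : M → L) t * (a : M → L) t = 0
        rw [ha t ht, mul_zero] }
  suffices htop : (vanish T ⊔ vanish E).comap i ⊔ pairIdeal Γ M 𝔪 = ⊤ by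
    obtain ⟨c, hc, b, hb, hcb⟩ := Submodule.mem_sup.1
      (htop ▸ Submodule.mem_top : 1 ∈ (vanish T ⊔ vanish E).comap i ⊔ pairIdeal Γ M 𝔪)
    obtain ⟨x, hx, y, hy, hxy⟩ := Submodule.mem_sup.1 (Ideal.mem_comap.1 hc)
    refine ⟨-b, neg_mem hb, x, x.2, y, y.2, ?_, hx, hy⟩
    have h1 := congrArg Subtype.val hcb
    have h2 := congrArg Subtype.val hxy
    change (x : M → L) + y = c at h2
    change (c : M → L) + b = 1 at h1
    rw [h2, ← h1]
    change (c : M → L) + b + -b = c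
    rw [add_neg_cancel_right]
  by_contra hne
  obtain ⟨P, hP, hle⟩ := Ideal.exists_le_maximal _ hne
  have hPprime := hP.isPrime
  obtain ⟨Q, hQle, hQ, hQP⟩ : ∃ Q ≥ vanish T ⊔ vanish E, Q.IsPrime ∧ Q.comap i = P := by
    let _ : Algebra (pairRing M D) (pairRing M C) := i.toAlgebra
    have : Algebra.IsIntegral (pairRing M D) (pairRing M C) := ⟨hi⟩
    exact Ideal.exists_ideal_over_prime_of_isIntegral P (vanish T ⊔ vanish E)
      (le_sup_left.trans hle)
  have hΓ (γ : Γ) : algebraMap Γ L γ ∈ C := (baseClosure Γ K L).algebraMap_mem γ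
  obtain ⟨t, ht, ℓt, hℓt, hrt, hlt⟩ := exists_point_of_pairRing hB hC hΓ Q T
    fun a ha => hQle (Ideal.mem_sup_left ha)
  obtain ⟨e, he, ℓe, hℓe, hre, hle'⟩ := exists_point_of_pairRing hB hC hΓ Q E
    fun a ha => hQle (Ideal.mem_sup_right ha)
  have hright (γ : Γ) (hγ : γ ∈ 𝔪) : rightPair M C ⟨_, hΓ γ⟩ ∈ Q := by
    have h1 : (rightPair M D) ((algebraMap Γ L).rangeRestrict γ) ∈ Q.comap i := by
      rw [hQP]
      exact hle (Ideal.mem_sup_right (Ideal.mem_sup_right (Ideal.mem_map_of_mem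
        ((rightPair M _).comp (algebraMap Γ L).rangeRestrict) hγ)))
    exact h1
  have hleft (γ : Γ) (hγ : γ ∈ 𝔪) : leftPair M C ⟨_, hΓ γ⟩ ∈ Q := by
    have h1 : (leftPair M D) ((algebraMap Γ L).rangeRestrict γ) ∈ Q.comap i := by
      rw [hQP]
      exact hle (Ideal.mem_sup_right (Ideal.mem_sup_left (Ideal.mem_map_of_mem
        ((leftPair M _).comp (algebraMap Γ L).rangeRestrict) hγ)))
    exact h1
  have hmt : ℓt ∈ pointsOver L 𝔪 := mem_pointsOver h𝔪 hℓt fun γ hγ => (hrt _ (hΓ γ)).2 (hright γ hγ)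
  have hme : ℓe ∈ pointsOver L 𝔪 := mem_pointsOver h𝔪 hℓe fun γ hγ => (hre _ (hΓ γ)).2 (hright γ hγ)
  have hmt' : (⟨t, hB t.2⟩ : backMonoid Γ k L) • ℓt ∈ pointsOver L 𝔪 :=
    mem_pointsOver h𝔪 (isPrime_smul _ hℓt) fun γ hγ => (hlt _ (hΓ γ)).2 (hleft γ hγ)
  refine hT t ht ⟨?_, ℓt, hmt, hmt'⟩
  exact inv_mem_of_same_base hM hB t.2 e.2 (hE e he) hℓe (isMaximal_of_comap hℓt h𝔪 hmt.2)
    (hfin ℓe hme) (isMaximal_of_comap hmt'.1 h𝔪 hmt'.2)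
    (fun x hx => (hrt x hx).trans (hre x hx).symm) (fun x hx => (hlt x hx).trans (hle' x hx).symm)

/-- With `1 + b = x + y` as in `exists_split_one_sub` for the support of `u`, the summand `y`
vanishes at the units and `x` outside `unitMovers`. The unit part of `(1 + b) u` is therefore
exactly `x u`. -/
theorem exists_unitPart_mem [FiniteDimensional K L] [IsGalois K L]
    (hU : IsGaloisRing Γ hM U) (hB : M ≤ backMonoid Γ k L) {d : Γ}
    (hd : ∀ x ∈ baseClosure Γ K L, ∃ γ : Γ, algebraMap Γ L d * x = algebraMap Γ L γ)
    {𝔪 : Ideal Γ} (h𝔪 : 𝔪.IsMaximal)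
    (hfin : ∀ ℓ ∈ pointsOver L 𝔪, (stabilizer M ℓ).Finite)
    {u : SkewMonoidAlgebra L M} (hu : u ∈ U) :
    ∃ b ∈ pairIdeal Γ M 𝔪, unitPart (scale (1 + (b : M → L)) u) ∈
      supportedIn (boundedBy U.toAddSubgroup (baseClosure Γ K L).toSubring (algebraMap Γ L d))
        (unitMovers hB 𝔪) := by
  classical
  obtain ⟨b, hb, x, hx, y, hy, h, hxT, hyE⟩ := exists_split_one_sub (K := K) hM hB h𝔪 hfin
    (u.support.filter (· ∉ unitMovers hB 𝔪))
    (u.support.filter fun t : M => (t : L ≃ₐ[k] L)⁻¹ ∈ M)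
    (fun t ht => (Finset.mem_filter.1 ht).2) (fun t ht => (Finset.mem_filter.1 ht).2)
  refine ⟨b, hb, ?_⟩
  have hmem := scale_mem_bounded_movers hU hd hu hx (S := unitMovers hB 𝔪) fun t ht hne =>
    hxT t (Finset.mem_filter.2 ⟨SkewMonoidAlgebra.mem_support_iff.2 hne, ht⟩)
  convert hmem using 1
  ext t
  by_cases ht : (t : L ≃ₐ[k] L)⁻¹ ∈ M
  · rw [coeff_unitPart_of_inv_mem ht, h, coeff_scale, coeff_scale]
    by_cases h0 : u.coeff t = 0
    · rw [h0, mul_zero, mul_zero]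
    · rw [Pi.add_apply, hyE t (Finset.mem_filter.2 ⟨SkewMonoidAlgebra.mem_support_iff.2 h0, ht⟩),
        add_zero]
  · rw [coeff_unitPart_of_inv_notMem ht, hmem.2 t fun h => ht h.1]

end Approximation

section ScaleHom

variable {k Γ K L : Type*} [Field k] [CommRing Γ]
  [Field K] [Algebra k K] [Field L] [Algebra k L] [Algebra Γ L] [Algebra K L]
  [IsScalarTower k K L]
  {M : Submonoid (L ≃ₐ[k] L)} {hM : IsConjClosed K M} {U : Subring (SkewMonoidAlgebra L M)}

theorem IsGaloisRing.scale_pairFun_eq (hU : IsGaloisRing Γ hM U) (x y : Γ) (v : U)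
    (h : scale (pairFun M (algebraMap Γ L x) (algebraMap Γ L y)) (v : SkewMonoidAlgebra L M) ∈ U) :
    (⟨_, h⟩ : U) = hU.incl x * v * hU.incl y :=
  Subtype.ext (scale_pairFun _ _ _)

/-- The multiplication of the coefficients of an element of `U` by the values of functions. -/
noncomputable def IsGaloisRing.scaleHom (hU : IsGaloisRing Γ hM U) (u : U) :
    pairRing M (algebraMap Γ L).range →+ U :=
  AddMonoidHom.mk' (fun b => ⟨scale b u, hU.scale_mem b.2 u.2⟩) fun _ _ =>
    Subtype.ext (scale_add _ _ _)

theorem IsGaloisRing.scaleHom_mul (hU : IsGaloisRing Γ hM U) (u : U)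
    (a b : pairRing M (algebraMap Γ L).range) :
    hU.scaleHom u (a * b) = hU.scaleHom (hU.scaleHom u b) a :=
  Subtype.ext (scale_mul _ _ _)

theorem IsGaloisRing.scaleHom_leftPair (hU : IsGaloisRing Γ hM U) (u : U) (γ : Γ) :
    hU.scaleHom u (leftPair M _ ((algebraMap Γ L).rangeRestrict γ)) = hU.incl γ * u :=
  Subtype.ext ((scale_pairFun _ _ _).trans (mul_one _))

theorem IsGaloisRing.scaleHom_rightPair (hU : IsGaloisRing Γ hM U) (u : U) (γ : Γ) :
    hU.scaleHom u (rightPair M _ ((algebraMap Γ L).rangeRestrict γ)) = u * hU.incl γ :=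
  Subtype.ext ((scale_pairFun _ _ _).trans
    (congrArg (· * _) (one_mul (u : SkewMonoidAlgebra L M))))

end ScaleHom

/-! ### Scaling inside left ideals over `𝔪`. -/

section LeftIdealStability

variable {k Γ K L : Type*} [Field k] [IsAlgClosed k] [CommRing Γ] [Algebra k Γ]
  [Algebra.FiniteType k Γ]
  [Field K] [Algebra k K] [Field L] [Algebra k L] [Algebra Γ L] [Algebra K L]
  [IsScalarTower k K L] [IsScalarTower k Γ L]
  {M : Submonoid (L ≃ₐ[k] L)} {hM : IsConjClosed K M} {U : Subring (SkewMonoidAlgebra L M)}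

variable {𝔪 : Ideal Γ} {I : Submodule U U}

theorem IsGaloisRing.mul_incl_mem (hU : IsGaloisRing Γ hM U) (h𝔪 : 𝔪.IsMaximal)
    (hI : ∀ γ ∈ 𝔪, hU.incl γ ∈ I) {v : U} (hv : v ∈ I) (γ : Γ) : v * hU.incl γ ∈ I := by
  obtain ⟨c, hc⟩ := exists_sub_algebraMap_mem (k := k) h𝔪 γ
  have h : v * hU.incl γ = hU.incl (algebraMap k Γ c) * v +
      v * hU.incl (γ - algebraMap k Γ c) := by
    rw [hU.incl_algebraMap_mul_comm, map_sub]
    noncomm_ring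
  rw [h]
  exact add_mem (I.smul_mem _ hv) (I.smul_mem _ (hI _ hc))

theorem IsGaloisRing.scale_mem_leftIdeal (hU : IsGaloisRing Γ hM U) (h𝔪 : 𝔪.IsMaximal)
    (hI : ∀ γ ∈ 𝔪, hU.incl γ ∈ I) {v : U} (hv : v ∈ I) {a : M → L}
    (ha : a ∈ pairRing M (algebraMap Γ L).range) :
    (⟨scale a v, hU.scale_mem ha v.2⟩ : U) ∈ I := by
  suffices ∃ h : scale a (v : SkewMonoidAlgebra L M) ∈ U, (⟨_, h⟩ : U) ∈ I from this.2
  refine pairRing_induction (p := fun a => ∃ h : scale a (v : SkewMonoidAlgebra L M) ∈ U,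
    (⟨_, h⟩ : U) ∈ I) ?_ ?_ ?_ ?_ ha
  · rintro _ ⟨x, rfl⟩ _ ⟨y, rfl⟩
    refine ⟨hU.scale_mem (pairFun_mem_pairRing ⟨x, rfl⟩ ⟨y, rfl⟩) v.2, ?_⟩
    rw [hU.scale_pairFun_eq]
    exact hU.mul_incl_mem h𝔪 hI (I.smul_mem _ hv) y
  · refine ⟨by rw [scale_zero]; exact zero_mem _, ?_⟩
    simp only [scale_zero]
    exact zero_mem I
  · rintro a b ⟨ha, ha'⟩ ⟨hb, hb'⟩
    refine ⟨by rw [scale_add]; exact add_mem ha hb, ?_⟩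
    simp only [scale_add]
    exact add_mem ha' hb'
  · rintro a ⟨ha, ha'⟩
    refine ⟨by rw [scale_neg]; exact neg_mem ha, ?_⟩
    simp only [scale_neg]
    exact neg_mem ha'

/-- For `γ ∈ 𝔪`, the product `u γ` always lies in `I`, whereas `γ u ∈ I` uses that `u` is a scalar
modulo `I`. Stability of `I` under scaling extends this to the ideal generated. -/
theorem IsGaloisRing.scale_pairIdeal_mem (hU : IsGaloisRing Γ hM U) (h𝔪 : 𝔪.IsMaximal)
    (hI : ∀ γ ∈ 𝔪, hU.incl γ ∈ I) {u : U} {c : k} (hu : u - hU.incl (algebraMap k Γ c) ∈ I)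
    {b : pairRing M (algebraMap Γ L).range} (hb : b ∈ pairIdeal Γ M 𝔪) :
    hU.scaleHom u b ∈ I := by
  let J : Ideal (pairRing M (algebraMap Γ L).range) :=
    { I.toAddSubgroup.comap (hU.scaleHom u) with
      smul_mem' := fun a b hb => by
        change hU.scaleHom u (a * b) ∈ I
        rw [hU.scaleHom_mul]
        exact hU.scale_mem_leftIdeal h𝔪 hI hb a.2 }
  have hJ : pairIdeal Γ M 𝔪 ≤ J := by
    refine sup_le (Ideal.map_le_iff_le_comap.2 fun γ hγ => ?_)
      (Ideal.map_le_iff_le_comap.2 fun γ hγ => ?_)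
    · change hU.scaleHom u (leftPair M _ ((algebraMap Γ L).rangeRestrict γ)) ∈ I
      have h : hU.incl γ * u = hU.incl γ * (u - hU.incl (algebraMap k Γ c)) +
          hU.incl (algebraMap k Γ c) * hU.incl γ := by
        rw [hU.incl_algebraMap_mul_comm]
        noncomm_ring
      rw [hU.scaleHom_leftPair, h]
      exact add_mem (I.smul_mem _ hu) (I.smul_mem _ (hI γ hγ))
    · change hU.scaleHom u (rightPair M _ ((algebraMap Γ L).rangeRestrict γ)) ∈ I
      rw [hU.scaleHom_rightPair]
      exact I.smul_mem _ (hI γ hγ)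
  exact hJ hb

end LeftIdealStability

/-! ### Finiteness of the fiber. -/

section Fibers

variable {k Γ K L : Type*} [Field k] [IsAlgClosed k] [CommRing Γ] [Algebra k Γ]
  [Algebra.FiniteType k Γ]
  [Field K] [Algebra k K] [Algebra Γ K] [Field L] [Algebra k L] [Algebra Γ L] [Algebra K L]
  [IsScalarTower k K L] [IsScalarTower k Γ L] [IsScalarTower Γ K L]
  [FiniteDimensional K L] [IsGalois K L]
  {M : Submonoid (L ≃ₐ[k] L)} {hM : IsConjClosed K M} {U : Subring (SkewMonoidAlgebra L M)}
  {𝔪 : Ideal Γ}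

/-- The replacement `u' = (1 + b) u` is chosen before `I` and `c`, so it serves all left ideals
simultaneously. -/
theorem IsGaloisRing.exists_unitPart_mem_approx
    (hU : IsGaloisRing Γ hM U) (hB : M ≤ backMonoid Γ k L) {d : Γ}
    (hd : ∀ x ∈ baseClosure Γ K L, ∃ γ : Γ, algebraMap Γ L d * x = algebraMap Γ L γ)
    (h𝔪 : 𝔪.IsMaximal) (hfin : ∀ ℓ ∈ pointsOver L 𝔪, (stabilizer M ℓ).Finite) (u : U) :
    ∃ u' : U, unitPart (u' : SkewMonoidAlgebra L M) ∈
      supportedIn (boundedBy U.toAddSubgroup (baseClosure Γ K L).toSubring (algebraMap Γ L d))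
        (unitMovers hB 𝔪) ∧
      ∀ I : Submodule U U, (∀ γ ∈ 𝔪, hU.incl γ ∈ I) → ∀ c : k,
        u - hU.incl (algebraMap k Γ c) ∈ I → u' - u ∈ I := by
  obtain ⟨b, hb, h⟩ := exists_unitPart_mem hU hB hd h𝔪 hfin u.2
  refine ⟨hU.scaleHom u (1 + b), h, fun I hI c hc => ?_⟩
  have h1 := hU.scale_pairIdeal_mem h𝔪 hI hc hb
  have h2 : hU.scaleHom u 1 = u := Subtype.ext (scale_one _)
  rwa [map_add, h2, add_sub_cancel_left]

/-- Modulo the maximal left ideals containing `𝔪`, the elements of `U` that are congruent to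
scalars are combinations of finitely many elements. -/
theorem IsGaloisRing.exists_finset_congr [CharZero L] [Module.Finite Γ (integralClosure Γ L)]
    [IsNoetherianRing Γ] (hU : IsGaloisRing Γ hM U) (hR : IsRightOrder Γ hM U)
    (hinj : Function.Injective (algebraMap Γ L)) {d : Γ} (hd0 : d ≠ 0)
    (hd : ∀ x ∈ baseClosure Γ K L, ∃ γ : Γ, algebraMap Γ L d * x = algebraMap Γ L γ)
    (h𝔪 : 𝔪.IsMaximal) (hX : (pointsOver L 𝔪).Finite)
    (hfin : ∀ ℓ ∈ pointsOver L 𝔪, (stabilizer M ℓ).Finite) :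
    ∃ (n : ℕ) (q : Fin n → U), ∀ u : U, ∃ a : Fin n → k,
      ∀ I : Submodule U U, IsCoatom I → (∀ γ ∈ 𝔪, hU.incl γ ∈ I) → ∀ c : k,
        u - hU.incl (algebraMap k Γ c) ∈ I →
        u - ∑ l, hU.incl (algebraMap k Γ (a l)) * q l ∈ I := by
  classical
  have hB := hR.le_backMonoid hU
  let S := unitMovers hB 𝔪
  have hS : S.Finite := finite_unitMovers hB hX hfin
  let C := baseClosure Γ K L
  have hd0' : algebraMap Γ L d ≠ 0 := fun h => hd0 (hinj (h.trans (map_zero _).symm))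
  have hfg := fg_rightModule_boundedBy (C := C.toSubring) hd0' hU.mul_coeffHom_mem
    (fun γ => C.algebraMap_mem γ) (hR.fg_rightModule hU hS)
  let W := supportedIn (boundedBy U.toAddSubgroup C.toSubring (algebraMap Γ L d)) S
  have hW : ∀ w ∈ W, ∀ a : Γ, w * coeffHom Γ M a ∈ W :=
    mul_coeffHom_mem_supportedIn (mul_coeffHom_mem_boundedBy (C := C.toSubring)
      fun γ => C.algebraMap_mem γ) S
  -- Unit parts need not lie in `U`; those that occur in `W` form a finitely generated right
  -- `Γ`-module, and its generators are lifted to elements `q y` of `U`.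
  let N : AddSubgroup (SkewMonoidAlgebra L M) := W ⊓ U.toAddSubgroup.map unitPart
  have hN : ∀ w ∈ N, ∀ a : Γ, w * coeffHom Γ M a ∈ N := by
    rintro w ⟨hw, u, hu, rfl⟩ a
    refine ⟨hW _ hw a, u * coeffHom Γ M a, U.mul_mem hu (hU.coeffHom_mem a), ?_⟩
    exact unitPart_mul_coe _ _
  have hNfg : (rightModule Γ N hN).FG := by
    refine fg_of_le ?_ hfg
    rintro _ ⟨w, hw, rfl⟩
    exact ⟨w, hw.1, rfl⟩
  obtain ⟨s, hsN, hs⟩ := exists_finset_of_rightModule_fg hNfg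
  have hlift : ∀ y : s, ∃ v : U, unitPart (v : SkewMonoidAlgebra L M) = y := fun y => by
    obtain ⟨-, v, hv, h⟩ := hsN y.2
    exact ⟨⟨v, hv⟩, h⟩
  choose q hq using hlift
  let e := s.equivFin
  refine ⟨s.card, q ∘ e.symm, fun u => ?_⟩
  obtain ⟨u', hu', happrox⟩ := hU.exists_unitPart_mem_approx hB hd h𝔪 hfin u
  obtain ⟨γ, hγ⟩ := mem_rightSpan_finset (hs _ ⟨hu', u', u'.2, rfl⟩)
  choose a ha using fun γ : Γ => exists_sub_algebraMap_mem (k := k) h𝔪 γ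
  refine ⟨fun l => a (γ (e.symm l)), fun I hI hI𝔪 c hc => ?_⟩
  have h1 := happrox I hI𝔪 c hc
  -- Both terms have the same unit part, so the difference has no unit in its support.
  have h2 : u' - ∑ y : s, q y * hU.incl (γ y) ∈ I := by
    refine hU.mem_of_support hB h𝔪 hX hfin hI hI𝔪 fun t ht hinv => ?_
    refine SkewMonoidAlgebra.mem_support_iff.1 ht ?_
    rw [← coeff_unitPart_of_inv_mem hinv]
    have h3 : unitPart ((u' - ∑ y : s, q y * hU.incl (γ y) : U) : SkewMonoidAlgebra L M) = 0 := by
      have h4 : ((u' - ∑ y : s, q y * hU.incl (γ y) : U) : SkewMonoidAlgebra L M) =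
          u' - ∑ y : s, (q y : SkewMonoidAlgebra L M) * coeffHom Γ M (γ y) := by
        push_cast
        rfl
      rw [h4, map_sub, hγ, map_sum, ← Finset.sum_coe_sort s, sub_eq_zero]
      refine Finset.sum_congr rfl fun y _ => ?_
      rw [coeffHom_apply, unitPart_mul_coe, hq]
    rw [h3]
    rfl
  -- Modulo `I`, a right factor from `Γ` may be replaced by its residue in `k`, which is central.
  have h5 : ∑ y : s, q y * hU.incl (γ y) -
      ∑ y : s, hU.incl (algebraMap k Γ (a (γ y))) * q y ∈ I := by
    rw [← Finset.sum_sub_distrib]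
    refine sum_mem fun y _ => ?_
    rw [hU.incl_algebraMap_mul_comm, ← mul_sub, ← map_sub]
    exact I.smul_mem _ (hI𝔪 _ (ha _))
  have h6 : ∑ l, hU.incl (algebraMap k Γ (a (γ (e.symm l)))) * (q ∘ e.symm) l =
      ∑ y : s, hU.incl (algebraMap k Γ (a (γ y))) * q y :=
    e.symm.sum_comp fun y : s => hU.incl (algebraMap k Γ (a (γ y))) * q y
  rw [h6]
  have h7 := add_mem (sub_mem h2 h1) h5
  convert h7 using 1
  abel

/-- Given `n + 1` non-isomorphic simple quotients, density provides `u i` congruent to `δᵢⱼ` modulo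
`I j`. Their coordinate vectors in `kⁿ` are linearly dependent, and a dependence `g` puts each
scalar `g j` into `I j`; a nonzero one contradicts properness. -/
theorem IsGaloisRing.finite_fiber [CharZero L] [Module.Finite Γ (integralClosure Γ L)]
    [IsNoetherianRing Γ] (hU : IsGaloisRing Γ hM U) (hR : IsRightOrder Γ hM U)
    (hinj : Function.Injective (algebraMap Γ L)) {d : Γ} (hd0 : d ≠ 0)
    (hd : ∀ x ∈ baseClosure Γ K L, ∃ γ : Γ, algebraMap Γ L d * x = algebraMap Γ L γ)
    (h𝔪 : 𝔪.IsMaximal) (hX : (pointsOver L 𝔪).Finite)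
    (hfin : ∀ ℓ ∈ pointsOver L 𝔪, (stabilizer M ℓ).Finite) :
    Finite (Fiber hU.incl 𝔪) := by
  classical
  obtain ⟨n, q, hq⟩ := hU.exists_finset_congr hR hinj hd0 hd h𝔪 hX hfin
  by_contra hinf
  rw [not_finite_iff_infinite] at hinf
  let f : Fin (n + 1) ↪ Fiber hU.incl 𝔪 :=
    (Fin.valEmbedding).trans (Infinite.natEmbedding (Fiber hU.incl 𝔪))
  let J (i : Fin (n + 1)) : MaxLeftIdealOver hU.incl 𝔪 := Quotient.out (f i)
  let I (i : Fin (n + 1)) : Submodule U U := (J i).1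
  have hne : ∀ i j, i ≠ j → IsEmpty ((U ⧸ I i) ≃ₗ[U] (U ⧸ I j)) := by
    intro i j hij
    refine ⟨fun e => hij (f.injective ?_)⟩
    rw [← Quotient.out_eq (f i), ← Quotient.out_eq (f j)]
    exact Quotient.sound ⟨e⟩
  have hI (i) : IsCoatom (I i) := (J i).2.1
  have hI𝔪 (i) : ∀ γ ∈ 𝔪, hU.incl γ ∈ I i := (J i).2.2
  choose u hu hu' using exists_sub_one_mem_of_pairwise hI hne
  choose a ha using hq
  have hscalar (i j) : u i - hU.incl (algebraMap k Γ (if i = j then 1 else 0)) ∈ I j := by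
    by_cases h : i = j
    · subst h
      simpa using hu i
    · simpa [h] using hu' i j (Ne.symm h)
  have hkey (i j) : hU.incl (algebraMap k Γ (if i = j then 1 else 0)) -
      ∑ l, hU.incl (algebraMap k Γ (a (u i) l)) * q l ∈ I j := by
    have := sub_mem (ha (u i) (I j) (hI j) (hI𝔪 j) _ (hscalar i j)) (hscalar i j)
    convert this using 1
    abel
  obtain ⟨g, hg, j, hj⟩ : ∃ g : Fin (n + 1) → k, (∑ i, g i • a (u i) = 0) ∧ ∃ j, g j ≠ 0 := by
    have hdep : ¬ LinearIndependent k fun i => a (u i) := by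
      intro h
      have := h.fintype_card_le_finrank
      simp at this
    obtain ⟨g, hg, j, hj⟩ := Fintype.not_linearIndependent_iff.1 hdep
    exact ⟨g, hg, j, hj⟩
  have h1 : ∑ i, hU.incl (algebraMap k Γ (g i)) *
      (hU.incl (algebraMap k Γ (if i = j then 1 else 0)) -
        ∑ l, hU.incl (algebraMap k Γ (a (u i) l)) * q l) ∈ I j :=
    sum_mem fun i _ => (I j).smul_mem _ (hkey i j)
  have h2 : ∑ i, hU.incl (algebraMap k Γ (g i)) *
      (∑ l, hU.incl (algebraMap k Γ (a (u i) l)) * q l) = 0 := by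
    simp only [Finset.mul_sum, ← mul_assoc, ← map_mul]
    rw [Finset.sum_comm]
    refine Finset.sum_eq_zero fun l _ => ?_
    rw [← Finset.sum_mul, ← map_sum, ← map_sum]
    have := congrFun hg l
    simp only [Finset.sum_apply, Pi.smul_apply, smul_eq_mul, Pi.zero_apply] at this
    rw [this, map_zero, map_zero, zero_mul]
  simp only [mul_sub] at h1
  rw [Finset.sum_sub_distrib, h2, sub_zero] at h1
  simp only [← map_mul, mul_ite, mul_one, mul_zero] at h1
  rw [← map_sum, ← map_sum, Finset.sum_ite_eq' Finset.univ j, if_pos (Finset.mem_univ j)] at h1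
  refine (hI j).1 ((Submodule.eq_top_iff').2 fun v => ?_)
  have h3 := (I j).smul_mem (v * hU.incl (algebraMap k Γ (g j)⁻¹)) h1
  rwa [smul_eq_mul, mul_assoc, ← map_mul, ← map_mul, inv_mul_cancel₀ hj, map_one, map_one,
    mul_one] at h3

end Fibers

end GaloisOrder

theorem theoremA {k Γ K L : Type*}
    [Field k] [IsAlgClosed k] [CharZero k]
    [CommRing Γ] [IsDomain Γ] [Algebra k Γ] [Algebra.FiniteType k Γ]
    [Field K] [Algebra k K] [Algebra Γ K] [IsScalarTower k Γ K] [IsFractionRing Γ K]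
    [Field L] [Algebra k L] [Algebra Γ L] [Algebra K L]
    [IsScalarTower k K L] [IsScalarTower Γ K L]
    [FiniteDimensional K L] [IsGalois K L]
    (M : Submonoid (L ≃ₐ[k] L))
    (hM : GaloisOrder.IsConjClosed K M) (hsep : GaloisOrder.IsSeparating K M)
    (U : Subring (SkewMonoidAlgebra L M)) (hU : GaloisOrder.IsGaloisRing Γ hM U)
    (𝔪 : Ideal Γ) (h𝔪 : 𝔪.IsMaximal)
    (hfin : ∀ ℓ : Ideal (integralClosure Γ L), ℓ.IsMaximal →
      ℓ.comap (algebraMap Γ (integralClosure Γ L)) = 𝔪 →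
      (GaloisOrder.stabilizer M ℓ).Finite) :
    (GaloisOrder.IsRightOrder Γ hM U →
      Nonempty (GaloisOrder.Fiber hU.incl 𝔪) ∧
      GaloisOrder.leftIdealGen hU.incl 𝔪 ≠ ⊤ ∧
      ∃ I : Submodule U U, IsCoatom I ∧ (∀ γ ∈ 𝔪, hU.incl γ ∈ I) ∧
        IsSimpleModule U (U ⧸ I) ∧
        GaloisOrder.IsGelfandTsetlin hU.incl (U ⧸ I) ∧
        GaloisOrder.weightSpace hU.incl (U ⧸ I) 𝔪 ≠ ⊥) ∧
    (GaloisOrder.IsRightOrder Γ hM U ∧ GaloisOrder.IsLeftOrder Γ hM U →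
      Finite (GaloisOrder.Fiber hU.incl 𝔪)) := by
  have hL : IsScalarTower k Γ L := IsScalarTower.of_algebraMap_eq fun c => by
    rw [IsScalarTower.algebraMap_apply k K L, IsScalarTower.algebraMap_apply k Γ K,
      ← IsScalarTower.algebraMap_apply Γ K L]
  have hchar : CharZero L := charZero_of_injective_algebraMap (algebraMap k L).injective
  have hnoeth : IsNoetherianRing Γ := Algebra.FiniteType.isNoetherianRing k Γ
  have hint : Module.Finite Γ (integralClosure Γ L) :=
    GaloisOrder.finite_integralClosure k Γ K L
  have hX := GaloisOrder.finite_pointsOver (L := L) 𝔪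
  have hinj := GaloisOrder.algebraMap_injective_of_tower Γ K L
  obtain ⟨d, hd0, hd⟩ := GaloisOrder.exists_conductor (Γ := Γ) (K := K) (L := L)
  have hstab : ∀ ℓ ∈ GaloisOrder.pointsOver L 𝔪, (GaloisOrder.stabilizer M ℓ).Finite :=
    fun ℓ hℓ => hfin ℓ (GaloisOrder.isMaximal_of_comap hℓ.1 h𝔪 hℓ.2) hℓ.2
  refine ⟨fun hR => ?_, fun h => hU.finite_fiber h.1 hinj hd0 hd h𝔪 hX hstab⟩
  have hne := GaloisOrder.leftIdealGen_ne_top hinj hd0 hd hU hR h𝔪 hX hstab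
  obtain ⟨I, hI, hle⟩ :=
    (eq_top_or_exists_le_coatom (GaloisOrder.leftIdealGen hU.incl 𝔪)).resolve_left hne
  have hI𝔪 : ∀ γ ∈ 𝔪, hU.incl γ ∈ I := fun γ hγ => hle (Submodule.subset_span ⟨γ, hγ, rfl⟩)
  have hsimple : IsSimpleModule U (U ⧸ I) := isSimpleModule_iff_isCoatom.2 hI
  refine ⟨⟨Quotient.mk _ ⟨I, hI, hI𝔪⟩⟩, hne, I, hI, hI𝔪, hsimple,
    GaloisOrder.isGelfandTsetlin_quotient hU hR h𝔪 I hI𝔪, fun hbot => hI.1 ?_⟩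
  -- The class of `1` is killed by `𝔪`, so it is a weight vector; its vanishing would mean `I = U`.
  have h1 : (Submodule.Quotient.mk 1 : U ⧸ I) ∈ GaloisOrder.weightSpace hU.incl (U ⧸ I) 𝔪 := by
    refine ⟨1, fun γ hγ => ?_⟩
    rw [pow_one] at hγ
    rw [← Submodule.Quotient.mk_smul, smul_eq_mul, mul_one]
    exact (Submodule.Quotient.mk_eq_zero I).2 (hI𝔪 γ hγ)
  rw [hbot, AddSubgroup.mem_bot, Submodule.Quotient.mk_eq_zero] at h1
  exact I.eq_top_iff'.2 fun v => by simpa using I.smul_mem v h1
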